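/- Let $k\ge 2$ be an integer, let $\vec{s}=(s_1,\dots,s_{k-1},1)$ be an integer vector with $s_i\ge 2$ for $1\le i\le k-1$, put $s_k=1$, and let $n\ge \sum_{i=1}^{k-1}s_i+2$ be an integer. Write $[n]=\{1,\dots,n\}$. A $k$-subset $T=\{T(1)<\dots<T(k)\}$ of $[n]$ is called $\vec{s}$-stable if $T(j+1)-T(j)\ge s_j$ for $1\le j\le k-1$ and $T(k)-T(1)\le n-s_k$. Let $P(n,k,\vec{s})$ be the poset of all pairs $(A,B)$ of disjoint subsets of $[n]$ such that each of $A$ and $B$ contains an $\vec{s}$-stable $k$-subset of $[n]$, ordered by $(A_1,B_1)\le (A_2,B_2)$ if and only if $A_1\subseteq A_2$ and $B_1\subseteq B_2$. Let $\Delta(P(n,k,\vec{s}))$ be its order complex, i.e. the simplicial complex whose simplices are the nonempty finite chains of the poset. Then the geometric realization of $\Delta(P(n,k,\vec{s}))$ is homotopy equivalent to the sphere $\mathbb{S}^{\,n-\sum_{i=1}^{k-1}s_i-2}$. In particular, it is $\left(n-\sum_{i=1}^{k-1}s_i-3\right)$-connected, where a space $X$ is called $m$-connected, for an integer $m\ge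 -1$, if it is nonempty and, for every integer $0\le i\le m$, every continuous map $\mathbb{S}^i\to X$ is homotopic to a constant map. -/

import Mathlib

namespace StableKneser

/-- The order complex `Δ(P)` of a poset `P`: the abstract simplicial complex with vertex set `P`
whose simplices are the nonempty finite chains of `P`. -/
def orderComplex (P : Type*) [PartialOrder P] : AbstractSimplicialComplex P where
  faces := {σ | σ.Nonempty ∧ IsChain (· ≤ ·) (σ : Set P)}
  isRelLowerSet_faces := by
    rintro σ ⟨hσ, hc⟩
    exact ⟨hσ, fun τ hτ hne => ⟨hne, hc.mono (by exact_mod_cast hτ)⟩⟩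
  singleton_mem := fun v => ⟨Finset.singleton_nonempty v, by simp⟩

/-- The geometric realization `|K|` of an abstract simplicial complex `K` on a finite vertex set,
in barycentric coordinates: the points of the standard simplex whose support is a simplex of `K`,
with the topology induced from the finite-dimensional space `ι → ℝ`. -/
def realization {ι : Type*} [Fintype ι] (K : AbstractSimplicialComplex ι) : Set (ι → ℝ) :=
  {x | x ∈ stdSimplex ℝ ι ∧ ∃ σ ∈ K.faces, Function.support x = (σ : Set ι)}

/-- A finite set `T` of natural numbers is an `s`-stable `k`-subset of `[n] = {1, …, n}`: it has
exactly `k` elements `T(1) < ⋯ < T(k)`, all in `[n]`, with `T(j+1) - T(j) ≥ s_j` for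
`1 ≤ j ≤ k - 1` and `T(k) - T(1) ≤ n - s_k`. The vector `s = (s_1, …, s_k)` and the
strictly increasing enumeration `t` of `T` are indexed by `Fin k`, so `s_j` is `s` at index
`j - 1` and `T(j)` is `t` at index `j - 1`. -/
def IsStable (n k : ℕ) (s : Fin k → ℕ) (T : Finset ℕ) : Prop :=
  T ⊆ Finset.Icc 1 n ∧
  ∃ t : Fin k → ℕ, StrictMono t ∧ Finset.univ.image t = T ∧
    (∀ i j : Fin k, (i : ℕ) + 1 = j → t i + s i ≤ t j) ∧
    (∀ i j : Fin k, (i : ℕ) = 0 → (j : ℕ) + 1 = k → t j + s j ≤ t i + n)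

/-- The pairs `(A, B)` of disjoint subsets of `[n]` each of which contains an `s`-stable
`k`-subset of `[n]`. -/
def stablePairs (n k : ℕ) (s : Fin k → ℕ) : Set (Finset ℕ × Finset ℕ) :=
  {p | p.1 ⊆ Finset.Icc 1 n ∧ p.2 ⊆ Finset.Icc 1 n ∧ Disjoint p.1 p.2 ∧
    (∃ T, T ⊆ p.1 ∧ IsStable n k s T) ∧ (∃ T, T ⊆ p.2 ∧ IsStable n k s T)}

/-- The poset `P(n, k, s)`. Its order is inherited from the product order on pairs of finite sets:
`(A₁, B₁) ≤ (A₂, B₂)` iff `A₁ ⊆ A₂` and `B₁ ⊆ B₂`. -/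
abbrev StablePoset (n k : ℕ) (s : Fin k → ℕ) : Type := ↥(stablePairs n k s)

theorem stablePairs_finite (n k : ℕ) (s : Fin k → ℕ) : (stablePairs n k s).Finite := by
  refine Set.Finite.subset
    ((Finset.Icc 1 n).powerset ×ˢ (Finset.Icc 1 n).powerset).finite_toSet ?_
  rintro ⟨A, B⟩ ⟨hA, hB, -⟩
  exact Finset.mem_coe.2 (Finset.mem_product.2
    ⟨Finset.mem_powerset.2 hA, Finset.mem_powerset.2 hB⟩)

noncomputable instance instFintypeStablePoset (n k : ℕ) (s : Fin k → ℕ) : Fintype (StablePoset n k s) :=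
  (stablePairs_finite n k s).fintype

/-- The topological space `|Δ(P(n, k, s))|`. -/
abbrev StableSpace (n k : ℕ) (s : Fin k → ℕ) : Type :=
  ↥(realization (orderComplex (StablePoset n k s)))

/-- The unit sphere `S^d` in `ℝ^(d+1)`. -/
abbrev Sphere (d : ℕ) : Type := ↥(Metric.sphere (0 : EuclideanSpace ℝ (Fin (d + 1))) 1)

/-- A space `X` is `m`-connected (`m` an integer): it is nonempty if `m ≥ -1`, and for every
`0 ≤ i ≤ m` every continuous map `S^i → X` is homotopic to a constant map. Thus `(-1)`-connected
means nonempty, and there is no condition for `m ≤ -2`. -/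
def IsMConnected (m : ℤ) (X : Type*) [TopologicalSpace X] : Prop :=
  (-1 ≤ m → Nonempty X) ∧
  ∀ i : ℕ, (i : ℤ) ≤ m → ∀ f : C(Sphere i, X), f.Nullhomotopic

end StableKneser

/-!
Let `g j` be the least admissible gap between the `j`-th and the `(j+1)`-st element of a stable set.
Since `s_k = 1`, no condition relates the last element to the first, and a set contains a stable
`k`-subset iff the maximum over all stable `T` of the minimum of its indicator function on `T` is
`1`. The proof works with the real-valued version `phi g k n x` of this maximum of minima, a
continuous function of a vector `x`, which satisfies a recursion in `n`.

*From the poset to vectors.* A vector `x` has a chain of pairs of level sets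
`({x > c + t}, {x < c - t})`, `t > 0`, and conversely a point of the order complex is a convex
combination of pairs, that is, of sign vectors. This identifies the order complex up to homotopy
with the set `pairSet g k n k n` of all vectors `x` with `-phi (-x) < phi x`, for which some
threshold `c` leaves a stable set on either side (`stableSpace_equiv_pairSet`). All homotopies are
along segments.

*Induction on `n`.* Whether `x` belongs to `pairSet g k (n + 1) k (n + 1)` depends on the
last coordinate as follows: it is arbitrary if the other coordinates are already separated by a
threshold; otherwise it has to lie above both extremal thresholds, or below both, and then the other
coordinates belong to one of two larger sets `Zp` and `Zm`. So the set for `n + 1` is a double mapping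
cylinder of the inclusions of the set for `n` into `Zp` and `Zm` (`pairSet_succ_equiv`). Both `Zp` and
`Zm` are contractible (`contractibleSpace_pairSet`): raising or lowering one coordinate removes the
last element of a stable set from the conditions that define them, and as the gaps are at least `2`,
this can be done alternately on the two sides until no condition remains. Hence each step is a
suspension (`mappingCylinder_equiv_punctured`). For the smallest `n` that admits a stable set, this
set is unique, so there is no separated vector and the induction starts with the empty sphere
(`pairSet_eq_empty`).

*Connectivity.* A map `S^i → S^d` with `i < d` is null-homotopic, since a smooth approximation misses
a direction by a count of Hausdorff dimensions (`sphere_nullhomotopic`).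
-/

namespace StableKneser

open Set ContinuousMap Metric Module

/-! ### Homotopies along segments, and maps between spheres -/

/-- Two maps into a subset `S` of a topological vector space are homotopic if the segments joining
their values stay inside `S`. -/
theorem homotopic_of_segment_subset {X E : Type*} [TopologicalSpace X] [AddCommGroup E] [Module ℝ E]
    [TopologicalSpace E] [ContinuousAdd E] [ContinuousSMul ℝ E] {S : Set E} (f g : C(X, S))
    (h : ∀ x, ∀ u : ℝ, 0 ≤ u → u ≤ 1 → (1 - u) • (f x : E) + u • (g x : E) ∈ S) :
    f.Homotopic g :=
  ⟨{ toFun := fun p => ⟨(1 - (p.1 : ℝ)) • (f p.2 : E) + (p.1 : ℝ) • (g p.2 : E),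
        h p.2 _ p.1.2.1 p.1.2.2⟩
     continuous_toFun := by fun_prop
     map_zero_left := fun x => by ext; simp
     map_one_left := fun x => by ext; simp }⟩

theorem segment_ne_zero {E : Type*} [AddCommGroup E] [Module ℝ E] {v : E} (hv : v ≠ 0) {c u : ℝ}
    (hc : 0 < c) (h0 : 0 ≤ u) (h1 : u ≤ 1) : (1 - u) • v + u • c • v ≠ 0 := by
  rw [smul_smul, ← add_smul]
  have : 0 < 1 - u + u * c := by
    rcases h0.eq_or_lt with rfl | h0
    · simp
    · nlinarith [mul_pos h0 hc]
  exact smul_ne_zero this.ne' hv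

/-- A normed space without its origin is homotopy equivalent to its unit sphere. -/
noncomputable def puncturedEquivSphere (W : Type*) [NormedAddCommGroup W] [NormedSpace ℝ W] :
    HomotopyEquiv ({0}ᶜ : Set W) (sphere (0 : W) 1) where
  toFun := ⟨fun v => ⟨‖(v : W)‖⁻¹ • (v : W), by
      have : (v : W) ≠ 0 := v.2
      simp [norm_smul, this]⟩, by
    refine Continuous.subtype_mk (Continuous.smul (Continuous.inv₀ (by fun_prop) ?_) (by fun_prop)) _
    intro v
    have : (v : W) ≠ 0 := v.2
    simpa using this⟩
  invFun := ⟨fun v => ⟨v, by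
    have := norm_eq_of_mem_sphere v
    rintro h
    rw [mem_singleton_iff] at h
    simp [h] at this⟩, by fun_prop⟩
  left_inv := by
    refine Homotopic.symm (homotopic_of_segment_subset _ _ ?_)
    intro v u h0 h1
    have hv : (v : W) ≠ 0 := v.2
    exact segment_ne_zero hv (inv_pos.2 (norm_pos_iff.2 hv)) h0 h1
  right_inv := by
    convert Homotopic.refl _
    ext v
    simp

/-- A normed space without its origin is homotopy equivalent to the unit sphere of every isomorphic
normed space. -/
theorem punctured_equiv_sphere_of_linearEquiv {W W' : Type*} [NormedAddCommGroup W] [NormedSpace ℝ W]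
    [NormedAddCommGroup W'] [NormedSpace ℝ W'] (e : W ≃L[ℝ] W') :
    Nonempty (HomotopyEquiv ({0}ᶜ : Set W) (sphere (0 : W') 1)) := by
  have h : ({0}ᶜ : Set W) ≃ₜ ({0}ᶜ : Set W') :=
    e.toHomeomorph.subtype (fun x => by simp)
  exact ⟨h.toHomotopyEquiv.trans (puncturedEquivSphere W')⟩

/-- The positive multiples of the values on the unit sphere of a smooth map into a space of larger
dimension do not fill that space. -/
theorem exists_forall_smul_ne {E F : Type*} [NormedAddCommGroup E] [InnerProductSpace ℝ E]
    [FiniteDimensional ℝ E] [NormedAddCommGroup F] [NormedSpace ℝ F] [FiniteDimensional ℝ F]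
    (hEF : finrank ℝ E < finrank ℝ F) {q : E → F} (hq : ContDiff ℝ 1 q) :
    ∃ w : F, w ≠ 0 ∧ ∀ x ∈ sphere (0 : E) 1, ∀ r : ℝ, 0 < r → r • q x ≠ w := by
  let Q : E → F := fun x => ‖x‖ • q (‖x‖⁻¹ • x)
  have hQ : ∀ x ∈ ({0}ᶜ : Set E), ContDiffAt ℝ 1 Q x := by
    intro x hx
    have hn : ContDiffAt ℝ 1 (fun x : E => ‖x‖) x := contDiffAt_norm ℝ hx
    exact hn.smul (hq.contDiffAt.comp x
      ((hn.inv (norm_ne_zero_iff.2 hx)).smul contDiffAt_id))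
  have hdim : dimH (Q '' {0}ᶜ) < finrank ℝ F := by
    refine lt_of_le_of_lt (dimH_image_le_of_locally_lipschitzOn fun x hx => ?_) (?_ :
      dimH ({0}ᶜ : Set E) < _)
    · obtain ⟨K, t, ht, hK⟩ := (hQ x hx).exists_lipschitzOnWith
      exact ⟨K, t, mem_nhdsWithin_of_mem_nhds ht, hK⟩
    · exact lt_of_le_of_lt ((dimH_mono (subset_univ _)).trans_eq (Real.dimH_univ_eq_finrank E))
        (by exact_mod_cast hEF)
  have hF : Nontrivial F := finrank_pos_iff.1 (lt_of_le_of_lt (Nat.zero_le _) hEF)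
  obtain ⟨w, hw, hw0⟩ := (dense_compl_of_dimH_lt_finrank hdim).inter_open_nonempty
    ({0}ᶜ) isOpen_compl_singleton (exists_ne (0 : F))
  refine ⟨w, hw, fun x hx r hr h => hw0 ⟨r • x, ?_, ?_⟩⟩
  · have : ‖x‖ = 1 := by simpa using hx
    have hx0 : x ≠ 0 := by rintro rfl; simp at this
    exact smul_ne_zero hr.ne' hx0
  · have hx1 : ‖x‖ = 1 := by simpa using hx
    simp only [Q, norm_smul, hx1, Real.norm_of_nonneg hr.le, mul_one, smul_smul,
      inv_mul_cancel₀ hr.ne', one_smul, h]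

theorem nullhomotopic_of_equiv {A X Y : Type*} [TopologicalSpace A] [TopologicalSpace X]
    [TopologicalSpace Y] (e : HomotopyEquiv X Y) (f : C(A, X))
    (h : (e.toFun.comp f).Nullhomotopic) : f.Nullhomotopic := by
  obtain ⟨y, hy⟩ := h.comp_right e.invFun
  refine ⟨y, Homotopic.trans ?_ hy⟩
  rw [← ContinuousMap.comp_assoc]
  simpa using Homotopic.comp e.left_inv.symm (Homotopic.refl f)

/-- `π_i(S^d) = 0` for `i < d`: a map of spheres that raises the dimension is null-homotopic,
because a smooth approximation of it misses a direction. -/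
theorem sphere_nullhomotopic {E F : Type*} [NormedAddCommGroup E] [InnerProductSpace ℝ E]
    [FiniteDimensional ℝ E] [NormedAddCommGroup F] [NormedSpace ℝ F] [FiniteDimensional ℝ F]
    (hEF : finrank ℝ E < finrank ℝ F) (f : C(sphere (0 : E) 1, sphere (0 : F) 1)) :
    f.Nullhomotopic := by
  refine nullhomotopic_of_equiv (puncturedEquivSphere F).symm f ?_
  have : TietzeExtension F := TietzeExtension.of_tvs ℝ
  let f' : C(sphere (0 : E) 1, F) := ⟨fun x => f x, by fun_prop⟩
  obtain ⟨g, hg⟩ := f'.exists_restrict_eq isClosed_sphere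
  obtain ⟨q, hq, hqg, -⟩ := g.continuous.exists_contDiff_approx 1
    (continuous_const (y := (1 : ℝ))) (fun _ => one_pos)
  obtain ⟨w, hw0, hw⟩ := exists_forall_smul_ne hEF (q := q) (by exact_mod_cast hq)
  have hfx : ∀ x : sphere (0 : E) 1, g x = f x := fun x => by
    have := congrArg (fun k => k x) hg
    simpa [f'] using this
  have key : ∀ x : sphere (0 : E) 1, ∀ u : ℝ, 0 ≤ u → u ≤ 1 →
      (1 - u) • (f x : F) + u • q x ≠ 0 := by
    intro x u h0 h1 h
    have h2 : (f x : F) = - (u • (q x - f x)) := by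
      rw [eq_neg_iff_add_eq_zero]
      refine Eq.trans ?_ h
      module
    have h3 : ‖(f x : F)‖ = 1 := by simp
    have h4 : ‖q x - f x‖ < 1 := by
      have := hqg x
      rwa [hfx, dist_eq_norm] at this
    rw [h2, norm_neg, norm_smul, Real.norm_of_nonneg h0] at h3
    nlinarith [norm_nonneg (q x - f x)]
  have hq0 : ∀ x : sphere (0 : E) 1, q x ≠ 0 := fun x => by
    simpa using key x 1 zero_le_one le_rfl
  let q' : C(sphere (0 : E) 1, ({0}ᶜ : Set F)) :=
    ⟨fun x => ⟨q x, hq0 x⟩, (hq.continuous.comp continuous_subtype_val).subtype_mk _⟩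
  refine ⟨⟨-w, neg_ne_zero.2 hw0⟩, Homotopic.trans (homotopic_of_segment_subset _ q' key)
    (homotopic_of_segment_subset _ _ ?_)⟩
  intro x u h0 h1 h
  have h' : (1 - u) • q x = u • w := by
    have h5 : (1 - u) • q x + u • (-w) = 0 := h
    rwa [smul_neg, ← sub_eq_add_neg, sub_eq_zero] at h5
  rcases h0.eq_or_lt with rfl | h0
  · exact hq0 x (by simpa using h')
  rcases h1.eq_or_lt with rfl | h1
  · exact hw0 (by simpa using h'.symm)
  refine hw x x.2 (u⁻¹ * (1 - u)) (mul_pos (inv_pos.2 h0) (sub_pos.2 h1)) ?_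
  rw [mul_smul, h', smul_smul, inv_mul_cancel₀ h0.ne', one_smul]

theorem isMConnected_of_equiv_sphere {X : Type*} [TopologicalSpace X] {d : ℕ}
    (e : HomotopyEquiv X (Sphere d)) {m : ℤ} (hm : m < d) : IsMConnected m X := by
  refine ⟨fun _ => ?_, fun i hi f => ?_⟩
  · have : Nontrivial (EuclideanSpace ℝ (Fin (d + 1))) := by
      apply finrank_pos_iff (R := ℝ).1; simp
    obtain ⟨y⟩ := (NormedSpace.sphere_nonempty (E := EuclideanSpace ℝ (Fin (d + 1))) (x := 0)
      (r := 1)).2 zero_le_one |>.to_subtype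
    exact ⟨e.invFun y⟩
  · refine nullhomotopic_of_equiv e f (sphere_nullhomotopic ?_ _)
    simp only [finrank_euclideanSpace, Fintype.card_fin]
    omega

/-! ### Mapping cylinders with contractible ends -/

/-- A contraction of a subspace `Z`, run on the whole real line: it rests at the identity before
time `0` and at the point `pt` after time `1`. -/
structure Contraction {E : Type*} [TopologicalSpace E] (Z : Set E) where
  /-- the position at time `s` of the point that starts at `x` -/
  toFun : E → ℝ → E
  /-- the point to which `Z` contracts -/
  pt : E
  continuousOn : ContinuousOn (fun q : E × ℝ => toFun q.1 q.2) (Z ×ˢ univ)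
  mem : ∀ x ∈ Z, ∀ s, toFun x s ∈ Z
  pt_mem : pt ∈ Z
  of_nonpos : ∀ x ∈ Z, ∀ s ≤ 0, toFun x s = x
  of_one_le : ∀ x ∈ Z, ∀ s, 1 ≤ s → toFun x s = pt

theorem nonempty_contraction {E : Type*} [TopologicalSpace E] (Z : Set E)
    (hZ : ContractibleSpace Z) : Nonempty (Contraction Z) := by
  classical
  obtain ⟨p, ⟨H⟩⟩ := id_nullhomotopic Z
  refine ⟨⟨fun x s => if h : x ∈ Z then H (projIcc 0 1 zero_le_one s, ⟨x, h⟩) else x, p, ?_,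
    fun x hx s => ?_, p.2, fun x hx s hs => ?_, fun x hx s hs => ?_⟩⟩
  · rw [continuousOn_iff_continuous_domRestrict]
    have : Continuous fun q : (Z ×ˢ (univ : Set ℝ) : Set (E × ℝ)) =>
        (H (projIcc 0 1 zero_le_one q.1.2, ⟨q.1.1, q.2.1⟩) : E) := by
      fun_prop
    convert this using 2 with q
    simp [q.2.1]
  · simp [hx]
  · simp [hx, projIcc_of_le_left _ hs]
  · simp [hx, projIcc_of_right_le _ hs]

section Suspension

variable {E : Type*}

/-- The set of pairs `(x, T)` with `x ∈ U` for `-1 < T < 1`, `x ∈ Zp` for `1 ≤ T` and `x ∈ Zm`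
for `T ≤ -1`: a cylinder over `U` continued by half-infinite cylinders over `Zp` and `Zm`. -/
def longCylinder (U Zp Zm : Set E) : Set (E × ℝ) :=
  {q | (|q.2| < 1 → q.1 ∈ U) ∧ (1 ≤ q.2 → q.1 ∈ Zp) ∧ (q.2 ≤ -1 → q.1 ∈ Zm)}

/-- The double mapping cylinder `Zm × {-1} ∪ U × [-1, 1] ∪ Zp × {1}` of the inclusions of
`U` into `Zp` and `Zm`, with the topology induced from `E × ℝ`. If `Zp` and `Zm` are contractible,
it is a model of the suspension of `U`. -/
def mappingCylinder (U Zp Zm : Set E) : Set (E × ℝ) :=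
  {q | q ∈ longCylinder U Zp Zm ∧ |q.2| ≤ 1}

/-- Restriction of a real number to `[-1, 1]`. -/
def clip (T : ℝ) : ℝ := max (-1) (min 1 T)

theorem clip_of_abs_le {T : ℝ} (h : |T| ≤ 1) : clip T = T := by
  rw [abs_le] at h
  rw [clip, min_eq_right h.2, max_eq_right h.1]

theorem clip_of_one_le {T : ℝ} (h : 1 ≤ T) : clip T = 1 := by
  rw [clip, min_eq_left h, max_eq_right (by norm_num)]

theorem clip_of_le_neg_one {T : ℝ} (h : T ≤ -1) : clip T = -1 := by
  rw [clip, max_eq_left (min_le_right _ _ |>.trans h)]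

theorem continuous_clip : Continuous clip := by unfold clip; fun_prop

theorem abs_clip_le (T : ℝ) : |clip T| ≤ 1 :=
  abs_le.2 ⟨le_max_left _ _, max_le (by norm_num) (min_le_left _ _)⟩

variable {U Zp Zm : Set E}

theorem mem_right_of_gt (hp : U ⊆ Zp) {q : E × ℝ} (hq : q ∈ longCylinder U Zp Zm)
    (h : -1 < q.2) : q.1 ∈ Zp := by
  rcases lt_or_ge q.2 1 with h1 | h1
  · exact hp (hq.1 (abs_lt.2 ⟨h, h1⟩))
  · exact hq.2.1 h1

theorem mem_left_of_lt (hm : U ⊆ Zm) {q : E × ℝ} (hq : q ∈ longCylinder U Zp Zm)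
    (h : q.2 < 1) : q.1 ∈ Zm := by
  rcases lt_or_ge (-1) q.2 with h1 | h1
  · exact hm (hq.1 (abs_lt.2 ⟨h1, h⟩))
  · exact hq.2.2 h1

theorem right_mem_mappingCylinder {x : E} (hx : x ∈ Zp) : (x, (1 : ℝ)) ∈ mappingCylinder U Zp Zm :=
  ⟨⟨fun h => by simp at h, fun _ => hx, fun h => by norm_num at h⟩, by simp⟩

theorem left_mem_mappingCylinder {x : E} (hx : x ∈ Zm) :
    (x, (-1 : ℝ)) ∈ mappingCylinder U Zp Zm :=
  ⟨⟨fun h => by simp at h, fun h => by norm_num at h, fun _ => hx⟩, by simp⟩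

theorem mem_longCylinder (hp : U ⊆ Zp) (hm : U ⊆ Zm) {x : E} (hx : x ∈ U) (T : ℝ) :
    (x, T) ∈ longCylinder U Zp Zm :=
  ⟨fun _ => hx, fun _ => hp hx, fun _ => hm hx⟩

variable [TopologicalSpace E]

open Classical in
/-- The map from the long cylinder to the mapping cylinder that contracts the ends while `T`
runs from `1` to `2` and from `-1` to `-2`. -/
noncomputable def collapse (κp : Contraction Zp) (κm : Contraction Zm) (q : E × ℝ) : E × ℝ :=
  (if 0 ≤ q.2 then κp.toFun q.1 (q.2 - 1) else κm.toFun q.1 (-q.2 - 1), clip q.2)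

variable (κp : Contraction Zp) (κm : Contraction Zm)

theorem collapse_of_gt (hp : U ⊆ Zp) (hm : U ⊆ Zm) {q : E × ℝ} (hq : q ∈ longCylinder U Zp Zm)
    (h : -1 < q.2) : collapse κp κm q = (κp.toFun q.1 (q.2 - 1), clip q.2) := by
  unfold collapse
  split_ifs with h0
  · rfl
  · have hU := hq.1 (abs_lt.2 ⟨h, by linarith⟩)
    rw [κp.of_nonpos _ (hp hU) _ (by linarith), κm.of_nonpos _ (hm hU) _ (by linarith)]

theorem collapse_of_lt (hp : U ⊆ Zp) (hm : U ⊆ Zm) {q : E × ℝ} (hq : q ∈ longCylinder U Zp Zm)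
    (h : q.2 < 1) : collapse κp κm q = (κm.toFun q.1 (-q.2 - 1), clip q.2) := by
  unfold collapse
  split_ifs with h0
  · have hU := hq.1 (abs_lt.2 ⟨by linarith, h⟩)
    rw [κp.of_nonpos _ (hp hU) _ (by linarith), κm.of_nonpos _ (hm hU) _ (by linarith)]
  · rfl

theorem continuousOn_collapse (hp : U ⊆ Zp) (hm : U ⊆ Zm) :
    ContinuousOn (collapse κp κm) (longCylinder U Zp Zm) := by
  intro q hq
  rcases lt_or_ge (-1) q.2 with h | h
  · have hn : {r : E × ℝ | -1 < r.2} ∈ nhds q :=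
      (isOpen_lt continuous_const continuous_snd).mem_nhds h
    rw [← continuousWithinAt_inter hn]
    refine ContinuousWithinAt.congr (f := fun q => (κp.toFun q.1 (q.2 - 1), clip q.2)) ?_
      (fun r hr => collapse_of_gt κp κm hp hm hr.1 hr.2) (collapse_of_gt κp κm hp hm hq h)
    refine ContinuousWithinAt.prodMk ?_ (continuous_clip.comp continuous_snd).continuousWithinAt
    have h1 := κp.continuousOn (q.1, q.2 - 1)
      (mk_mem_prod (mem_right_of_gt hp hq h) (mem_univ _))
    refine ContinuousWithinAt.comp (f := fun r : E × ℝ => (r.1, r.2 - 1)) (x := q) h1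
      (by fun_prop) ?_
    exact fun r hr => mk_mem_prod (mem_right_of_gt hp hr.1 hr.2) (mem_univ _)
  · replace h : q.2 < 1 := by linarith
    have hn : {r : E × ℝ | r.2 < 1} ∈ nhds q :=
      (isOpen_lt continuous_snd continuous_const).mem_nhds h
    rw [← continuousWithinAt_inter hn]
    refine ContinuousWithinAt.congr (f := fun q => (κm.toFun q.1 (-q.2 - 1), clip q.2)) ?_
      (fun r hr => collapse_of_lt κp κm hp hm hr.1 hr.2) (collapse_of_lt κp κm hp hm hq h)
    refine ContinuousWithinAt.prodMk ?_ (continuous_clip.comp continuous_snd).continuousWithinAt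
    have h1 := κm.continuousOn (q.1, -q.2 - 1)
      (mk_mem_prod (mem_left_of_lt hm hq h) (mem_univ _))
    refine ContinuousWithinAt.comp (f := fun r : E × ℝ => (r.1, -r.2 - 1)) (x := q) h1
      (by fun_prop) ?_
    exact fun r hr => mk_mem_prod (mem_left_of_lt hm hr.1 hr.2) (mem_univ _)

theorem collapse_eq_self (hp : U ⊆ Zp) (hm : U ⊆ Zm) {q : E × ℝ}
    (hq : q ∈ longCylinder U Zp Zm) (h : |q.2| ≤ 1) : collapse κp κm q = q := by
  have h2 := abs_le.1 h
  rcases lt_or_ge (-1) q.2 with h1 | h1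
  · rw [collapse_of_gt κp κm hp hm hq h1, clip_of_abs_le h,
      κp.of_nonpos _ (mem_right_of_gt hp hq h1) _ (by linarith)]
  · replace h1 : q.2 < 1 := by linarith
    rw [collapse_of_lt κp κm hp hm hq h1, clip_of_abs_le h,
      κm.of_nonpos _ (mem_left_of_lt hm hq h1) _ (by linarith)]

theorem collapse_of_two_le (hp : U ⊆ Zp) (hm : U ⊆ Zm) {q : E × ℝ}
    (hq : q ∈ longCylinder U Zp Zm) (h : 2 ≤ q.2) : collapse κp κm q = (κp.pt, 1) := by
  rw [collapse_of_gt κp κm hp hm hq (by linarith), clip_of_one_le (by linarith),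
    κp.of_one_le _ (mem_right_of_gt hp hq (by linarith)) _ (by linarith)]

theorem collapse_of_le_neg_two (hp : U ⊆ Zp) (hm : U ⊆ Zm) {q : E × ℝ}
    (hq : q ∈ longCylinder U Zp Zm) (h : q.2 ≤ -2) : collapse κp κm q = (κm.pt, -1) := by
  rw [collapse_of_lt κp κm hp hm hq (by linarith), clip_of_le_neg_one (by linarith),
    κm.of_one_le _ (mem_left_of_lt hm hq (by linarith)) _ (by linarith)]

theorem collapse_mem (hp : U ⊆ Zp) (hm : U ⊆ Zm) {q : E × ℝ}
    (hq : q ∈ longCylinder U Zp Zm) : collapse κp κm q ∈ mappingCylinder U Zp Zm := by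
  rcases le_or_gt |q.2| 1 with h | h
  · rw [collapse_eq_self κp κm hp hm hq h]
    exact ⟨hq, h⟩
  · rcases lt_abs.1 h with h | h
    · rw [collapse_of_gt κp κm hp hm hq (by linarith), clip_of_one_le h.le]
      exact right_mem_mappingCylinder (κp.mem _ (hq.2.1 h.le) _)
    · rw [collapse_of_lt κp κm hp hm hq (by linarith), clip_of_le_neg_one (by linarith)]
      exact left_mem_mappingCylinder (κm.mem _ (hq.2.2 (by linarith)) _)

/-- A map into the mapping cylinder may be prescribed by a height function `T` and a map `a` into
`U` that is only defined where `|T| < 3`, since the ends are collapsed to points for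
`2 ≤ |T|`. -/
theorem exists_map_mappingCylinder (hp : U ⊆ Zp) (hm : U ⊆ Zm) {Y : Type*} [TopologicalSpace Y]
    (T : C(Y, ℝ)) (a : C({y | |T y| < 3}, U)) :
    ∃ Φ : C(Y, mappingCylinder U Zp Zm),
      (∀ y (h : |T y| < 3), (Φ y : E × ℝ) = collapse κp κm ((a ⟨y, h⟩ : E), T y)) ∧
      (∀ y, 3 ≤ T y → (Φ y : E × ℝ) = (κp.pt, 1)) ∧
      (∀ y, T y ≤ -3 → (Φ y : E × ℝ) = (κm.pt, -1)) := by
  classical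
  let S : Set Y := {y | |T y| < 3}
  let φ : Y → E × ℝ := fun y => if h : |T y| < 3 then collapse κp κm ((a ⟨y, h⟩ : E), T y)
    else if 0 < T y then (κp.pt, 1) else (κm.pt, -1)
  have hφ1 : ∀ y (h : |T y| < 3), φ y = collapse κp κm ((a ⟨y, h⟩ : E), T y) :=
    fun y h => by simp [φ, h]
  have hφ2 : ∀ y, 2 ≤ T y → φ y = (κp.pt, 1) := fun y h => by
    by_cases h3 : |T y| < 3
    · rw [hφ1 y h3]
      exact collapse_of_two_le κp κm hp hm (mem_longCylinder hp hm (a _).2 _) h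
    · have : 0 < T y := by linarith
      simp [φ, h3, this]
  have hφ3 : ∀ y, T y ≤ -2 → φ y = (κm.pt, -1) := fun y h => by
    by_cases h3 : |T y| < 3
    · rw [hφ1 y h3]
      exact collapse_of_le_neg_two κp κm hp hm (mem_longCylinder hp hm (a _).2 _) h
    · have : ¬ 0 < T y := by linarith
      simp [φ, h3, this]
  have hmem : ∀ y, φ y ∈ mappingCylinder U Zp Zm := fun y => by
    by_cases h3 : |T y| < 3
    · rw [hφ1 y h3]
      exact collapse_mem κp κm hp hm (mem_longCylinder hp hm (a _).2 _)
    · rcases le_abs.1 (not_lt.1 h3) with h | h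
      · rw [hφ2 y (by linarith)]
        exact right_mem_mappingCylinder κp.pt_mem
      · rw [hφ3 y (by linarith)]
        exact left_mem_mappingCylinder κm.pt_mem
  have hS : IsOpen S := isOpen_lt (by fun_prop) continuous_const
  have hcont : Continuous φ := by
    rw [continuous_iff_continuousAt]
    intro y
    by_cases h3 : |T y| < 3
    · have hon : ContinuousOn φ S := by
        rw [continuousOn_iff_continuous_domRestrict]
        have : Continuous fun y : S => collapse κp κm ((a y : E), T y) :=
          (continuousOn_collapse κp κm hp hm).comp_continuous (by fun_prop)
            fun y => mem_longCylinder hp hm (a y).2 _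
        convert this using 2 with y
        exact hφ1 y y.2
      exact hon.continuousAt (hS.mem_nhds h3)
    · rcases le_abs.1 (not_lt.1 h3) with h | h
      · have hn : {y | 2 < T y} ∈ nhds y :=
          (isOpen_lt continuous_const (by fun_prop)).mem_nhds (show 2 < T y by linarith)
        exact (continuousAt_const (y := (κp.pt, (1 : ℝ)))).congr
          (Filter.mem_of_superset hn fun z hz => (hφ2 z (le_of_lt hz)).symm)
      · have hn : {y | T y < -2} ∈ nhds y :=
          (isOpen_lt (by fun_prop) continuous_const).mem_nhds (show T y < -2 by linarith)
        exact (continuousAt_const (y := (κm.pt, (-1 : ℝ)))).congr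
          (Filter.mem_of_superset hn fun z hz => (hφ3 z (le_of_lt hz)).symm)
  exact ⟨⟨fun y => ⟨φ y, hmem y⟩, hcont.subtype_mk _⟩, hφ1, fun y h => hφ2 y (by linarith),
    fun y h => hφ3 y (by linarith)⟩

/-- A continuous map to the unit sphere that is only defined where the function `c` does not vanish
extends by zero to a continuous map on the whole space after multiplication by `c`. -/
theorem exists_smul_extension {V Y : Type*} [NormedAddCommGroup V] [NormedSpace ℝ V]
    [TopologicalSpace Y] (c : C(Y, ℝ)) (b : C({y | c y ≠ 0}, sphere (0 : V) 1)) :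
    ∃ Φ : C(Y, V), (∀ y (h : c y ≠ 0), Φ y = c y • (b ⟨y, h⟩ : V)) ∧ ∀ y, c y = 0 → Φ y = 0 := by
  classical
  let φ : Y → V := fun y => if h : c y ≠ 0 then c y • (b ⟨y, h⟩ : V) else 0
  have h1 : ∀ y (h : c y ≠ 0), φ y = c y • (b ⟨y, h⟩ : V) := fun y h => by simp [φ, h]
  have h2 : ∀ y, c y = 0 → φ y = 0 := fun y h => by simp [φ, h]
  have h3 : ∀ y, ‖φ y‖ ≤ |c y| := fun y => by
    by_cases h : c y = 0
    · simp [h2 y h]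
    · simp [h1 y h, norm_smul]
  have hS : IsOpen {y | c y ≠ 0} := isOpen_ne_fun (by fun_prop) continuous_const
  refine ⟨⟨φ, continuous_iff_continuousAt.2 fun y => ?_⟩, h1, h2⟩
  by_cases h : c y = 0
  · rw [ContinuousAt, h2 y h]
    refine squeeze_zero_norm h3 ?_
    have : Continuous fun y => |c y| := by fun_prop
    simpa [h] using this.tendsto y
  · refine ContinuousOn.continuousAt ?_ (hS.mem_nhds h)
    rw [continuousOn_iff_continuous_domRestrict]
    have : Continuous fun y : {y | c y ≠ 0} => c y • (b y : V) := by fun_prop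
    convert this using 2 with y
    exact h1 y y.2

end Suspension

/-! ### The suspension of a homotopy sphere -/

section Suspension

open unitInterval

variable {V : Type*} [NormedAddCommGroup V]

/-- The height on the punctured space `V × ℝ`, scaled so that it is `3` exactly on the part of the
upper half where `‖v‖ ≤ η`, and `-3` on the corresponding lower part. -/
noncomputable def slope (w : V × ℝ) : ℝ := 3 * w.2 / max |w.2| ‖w.1‖

theorem max_pos_of_ne_zero {w : V × ℝ} (hw : w ≠ 0) : 0 < max |w.2| ‖w.1‖ := by
  by_contra! h
  have h1 := (le_max_left _ _).trans h
  have h2 := (le_max_right _ _).trans h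
  exact hw (Prod.ext (norm_le_zero_iff.1 h2) (abs_nonpos_iff.1 h1))

theorem abs_slope (w : V × ℝ) : |slope w| = 3 * |w.2| / max |w.2| ‖w.1‖ := by
  have : 0 ≤ max |w.2| ‖w.1‖ := (abs_nonneg _).trans (le_max_left _ _)
  rw [slope, abs_div, abs_mul, abs_of_nonneg this, abs_of_pos (by norm_num : (0 : ℝ) < 3)]

theorem abs_slope_lt_iff {w : V × ℝ} (hw : w ≠ 0) : |slope w| < 3 ↔ |w.2| < ‖w.1‖ := by
  rw [abs_slope, div_lt_iff₀ (max_pos_of_ne_zero hw)]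
  have : 3 * |w.2| < 3 * max |w.2| ‖w.1‖ ↔ |w.2| < max |w.2| ‖w.1‖ := by
    constructor <;> intro h <;> linarith
  rw [this, lt_max_iff]
  simp

theorem fst_ne_zero_of_abs_slope_lt {w : V × ℝ} (hw : w ≠ 0) (h : |slope w| < 3) : w.1 ≠ 0 := by
  rw [abs_slope_lt_iff hw] at h
  exact norm_pos_iff.1 ((abs_nonneg _).trans_lt h)

theorem slope_eq_zero_iff {w : V × ℝ} (hw : w ≠ 0) : slope w = 0 ↔ w.2 = 0 := by
  rw [slope, div_eq_zero_iff]
  simp [(max_pos_of_ne_zero hw).ne']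

theorem slope_mul_nonneg (w : V × ℝ) : 0 ≤ slope w * w.2 := by
  have : 0 ≤ max |w.2| ‖w.1‖ := (abs_nonneg _).trans (le_max_left _ _)
  rw [slope, div_mul_eq_mul_div, mul_assoc]
  exact div_nonneg (by nlinarith [mul_self_nonneg w.2]) this

theorem continuous_slope : Continuous fun w : ({0}ᶜ : Set (V × ℝ)) => slope (w : V × ℝ) := by
  unfold slope
  exact Continuous.div (by fun_prop) (by fun_prop) fun w => (max_pos_of_ne_zero w.2).ne'

theorem clip_eq_zero_iff {T : ℝ} : clip T = 0 ↔ T = 0 := by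
  unfold clip
  constructor
  · intro h
    rcases max_choice (-1) (min 1 T) with h1 | h1 <;> rcases min_choice 1 T with h2 | h2 <;> linarith
  · rintro rfl; norm_num

theorem abs_clip_lt_iff {T : ℝ} : |clip T| < 1 ↔ |T| < 1 := by
  constructor
  · intro h
    by_contra! h1
    rcases le_abs.1 h1 with h1 | h1
    · simp [clip_of_one_le h1] at h
    · simp [clip_of_le_neg_one (show T ≤ -1 by linarith)] at h
  · intro h
    rwa [clip_of_abs_le h.le]

theorem clip_mul_nonneg {T y : ℝ} (h : 0 ≤ T * y) : 0 ≤ clip T * y := by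
  rcases le_or_gt |T| 1 with h1 | h1
  · rwa [clip_of_abs_le h1]
  · rcases lt_abs.1 h1 with h1 | h1
    · rw [clip_of_one_le h1.le]; nlinarith
    · rw [clip_of_le_neg_one (by linarith)]; nlinarith

variable {E : Type*} {U Zp Zm : Set E}

/-- Moving the height of a point of the mapping cylinder outwards, to a value `T` of the same sign,
does not leave the long cylinder. -/
theorem segment_mem_longCylinder (hp : U ⊆ Zp) (hm : U ⊆ Zm) {q : E × ℝ}
    (hq : q ∈ mappingCylinder U Zp Zm) {T : ℝ} (hT : |q.2| ≤ |T|) (hs : 0 ≤ T * q.2)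
    {u : ℝ} (h1 : u ≤ 1) : (q.1, (1 - u) * T + u * q.2) ∈ longCylinder U Zp Zm := by
  rcases lt_or_ge |q.2| 1 with h | h
  · exact mem_longCylinder hp hm (hq.1.1 h) _
  · have h3 := hq.2
    rcases le_abs.1 h with h2 | h2
    · have hq2 : q.2 = 1 := le_antisymm (abs_le.1 h3).2 h2
      have hx := hq.1.2.1 h2
      have hT1 : 1 ≤ T := by
        rw [hq2] at hT hs
        rw [abs_one, abs_of_nonneg (by linarith)] at hT
        exact hT
      have h5 : 1 ≤ (1 - u) * T + u * q.2 := by rw [hq2]; nlinarith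
      refine ⟨fun h => ?_, fun _ => hx, fun h => ?_⟩
      · have := (abs_lt.1 h).2
        simp only at this; linarith
      · simp only at h; linarith
    · have hq2 : q.2 = -1 := le_antisymm (by linarith) (abs_le.1 h3).1
      have hx := hq.1.2.2 (by linarith)
      have hT1 : T ≤ -1 := by
        rw [hq2] at hT hs
        rw [abs_neg, abs_one, abs_of_nonpos (by linarith)] at hT
        linarith
      have h5 : (1 - u) * T + u * q.2 ≤ -1 := by rw [hq2]; nlinarith
      refine ⟨fun h => ?_, fun h => ?_, fun _ => hx⟩
      · have := (abs_lt.1 h).1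
        simp only at this; linarith
      · simp only at h; linarith

variable [NormedSpace ℝ V] [TopologicalSpace E]

/-- If `U` is homotopy equivalent to the unit sphere of `V` and `Zp`, `Zm` are contractible, then
the mapping cylinder of `U` into `Zp` and `Zm` is homotopy equivalent to the punctured space
`V × ℝ`. -/
theorem mappingCylinder_equiv_punctured (hp : U ⊆ Zp) (hm : U ⊆ Zm) (hZp : ContractibleSpace Zp)
    (hZm : ContractibleSpace Zm) (e : HomotopyEquiv U (sphere (0 : V) 1)) :
    Nonempty (HomotopyEquiv (mappingCylinder U Zp Zm) ({0}ᶜ : Set (V × ℝ))) := by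
  obtain ⟨κp⟩ := nonempty_contraction Zp hZp
  obtain ⟨κm⟩ := nonempty_contraction Zm hZm
  let Y := mappingCylinder U Zp Zm
  let W : Set (V × ℝ) := {0}ᶜ
  obtain ⟨Hl⟩ := e.left_inv
  obtain ⟨Hr⟩ := e.right_inv
  -- The point `(x, t)` goes to `((1 - |t|) • e x, t)`, which involves `e x` only for `|t| < 1`.
  let c : C(Y, ℝ) := ⟨fun y => 1 - |y.1.2|, by fun_prop⟩
  have hc0 : ∀ y : Y, 0 ≤ c y := fun y => sub_nonneg.2 y.2.2
  have hcU : ∀ y : Y, c y ≠ 0 → y.1.1 ∈ U := fun y hy =>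
    y.2.1.1 (sub_pos.1 ((hc0 y).lt_of_ne' hy))
  obtain ⟨φ, hφ1, hφ2⟩ := exists_smul_extension c
    ⟨fun y => e.toFun ⟨y.1.1.1, hcU y.1 y.2⟩, by fun_prop⟩
  have hφn : ∀ y, ‖φ y‖ = c y := fun y => by
    by_cases h : c y = 0
    · rw [hφ2 y h, h, norm_zero]
    · rw [hφ1 y h]
      simp [norm_smul, abs_of_nonneg (hc0 y)]
  have hF0 : ∀ y : Y, (φ y, y.1.2) ∈ W := fun y h => by
    have h1 : φ y = 0 := congrArg Prod.fst h
    have h2 : y.1.2 = 0 := congrArg Prod.snd h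
    have := hφn y
    simp [h1, c, h2] at this
  let F : C(Y, W) := ⟨fun y => ⟨(φ y, y.1.2), hF0 y⟩, by fun_prop⟩
  -- Where `|T| < 3`, the first component of a vector is nonzero, so it has a direction to which the
  -- inverse of `e` applies.
  let N := puncturedEquivSphere V
  let T : C(W, ℝ) := ⟨fun w => slope (w : V × ℝ), continuous_slope⟩
  have hTv : ∀ w : W, |T w| < 3 → (w : V × ℝ).1 ≠ 0 := fun w h =>
    fst_ne_zero_of_abs_slope_lt w.2 h
  obtain ⟨G, hG1, hG2, hG3⟩ := exists_map_mappingCylinder κp κm hp hm T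
    ⟨fun w => e.invFun (N.toFun ⟨w.1.1.1, hTv w.1 w.2⟩), by fun_prop⟩
  have hGs : ∀ w : W, (G w : E × ℝ).2 = clip (T w) := fun w => by
    by_cases h : |T w| < 3
    · rw [hG1 w h]; rfl
    · rcases le_abs.1 (not_lt.1 h) with h | h
      · rw [hG2 w h, clip_of_one_le (by linarith)]
      · rw [hG3 w (by linarith), clip_of_le_neg_one (by linarith)]
  refine ⟨⟨F, G, ?_, ?_⟩⟩
  · -- The composite replaces `x` by `e⁻¹ (e x)` and stretches the height by the collapse of the ends.
    -- The homotopy `K` undoes the former and `J` undoes the latter.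
    let T1 : C(Y, ℝ) := T.comp F
    have hT1 : ∀ y : Y, |y.1.2| ≤ |T1 y| := fun y => by
      change _ ≤ |slope (φ y, y.1.2)|
      rw [abs_slope, le_div_iff₀ (max_pos_of_ne_zero (hF0 y))]
      have h1 : max |y.1.2| ‖φ y‖ ≤ 3 := max_le (by linarith [y.2.2]) (by
        rw [hφn]; change 1 - |y.1.2| ≤ 3; linarith [abs_nonneg y.1.2])
      rw [mul_comm]
      exact mul_le_mul_of_nonneg_right h1 (abs_nonneg _)
    have hT1s : ∀ y : Y, 0 ≤ T1 y * y.1.2 := fun y => slope_mul_nonneg _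
    have hT1c : ∀ y : Y, |T1 y| < 3 → c y ≠ 0 := fun y h => by
      have := hTv (F y) h
      intro hc
      exact this (hφ2 y hc)
    have hN : ∀ (y : Y) (h : |T1 y| < 3), N.toFun ⟨φ y, hTv (F y) h⟩ =
        e.toFun ⟨y.1.1, hcU y (hT1c y h)⟩ := fun y h => by
      have hc := hT1c y h
      ext1
      change ‖φ y‖⁻¹ • φ y = _
      rw [hφn, hφ1 y hc, smul_smul, inv_mul_cancel₀ hc, one_smul]
      rfl
    obtain ⟨K, hK1, hK2, hK3⟩ := exists_map_mappingCylinder κp κm hp hm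
      (T1.comp (ContinuousMap.snd : C(I × Y, Y)))
      ⟨fun z => Hl (z.1.1, ⟨z.1.2.1.1, hcU z.1.2 (hT1c _ z.2)⟩), by fun_prop⟩
    have hL : ∀ z : I × Y, ((z.2.1.1, (1 - (z.1 : ℝ)) * T1 z.2 + z.1 * z.2.1.2) : E × ℝ) ∈
        longCylinder U Zp Zm := fun z =>
      segment_mem_longCylinder hp hm z.2.2 (hT1 _) (hT1s _) z.1.2.2
    let J : C(I × Y, Y) :=
      ⟨fun z => ⟨_, collapse_mem κp κm hp hm (hL z)⟩,
        ((continuousOn_collapse κp κm hp hm).comp_continuous (by fun_prop) hL).subtype_mk _⟩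
    have hKJ : ∀ y, K (1, y) = J (0, y) := fun y => by
      ext1
      have hJ : (J (0, y) : E × ℝ) = collapse κp κm (y.1.1, T1 y) := by
        simp [J]
      have hl := hL (0, y)
      simp only [Icc.coe_zero, sub_zero, one_mul, zero_mul, add_zero] at hl
      rw [hJ]
      by_cases h : |T1 y| < 3
      · rw [hK1 (1, y) h]
        simp
      · rcases le_abs.1 (not_lt.1 h) with h | h
        · rw [hK2 (1, y) h, collapse_of_two_le κp κm hp hm hl (by simp only; linarith)]
        · rw [hK3 (1, y) (by change T1 y ≤ -3; linarith),
            collapse_of_le_neg_two κp κm hp hm hl (by simp only; linarith)]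
    have hK0 : ∀ y, K (0, y) = (G.comp F) y := fun y => by
      ext1
      by_cases h : |T1 y| < 3
      · rw [hK1 (0, y) h]
        refine Eq.trans ?_ (hG1 (F y) h).symm
        change collapse κp κm ((Hl (0, ⟨y.1.1, _⟩) : E), T1 y) =
          collapse κp κm ((e.invFun (N.toFun ⟨φ y, _⟩) : E), T1 y)
        rw [hN y h, Hl.apply_zero]
        rfl
      · rcases le_abs.1 (not_lt.1 h) with h | h
        · exact (hK2 (0, y) h).trans (hG2 (F y) h).symm
        · exact (hK3 (0, y) (by change T1 y ≤ -3; linarith)).trans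
            (hG3 (F y) (by change T1 y ≤ -3; linarith)).symm
    have hJ1 : ∀ y, J (1, y) = y := fun y => by
      ext1
      have hJ : (J (1, y) : E × ℝ) = collapse κp κm y.1 := by
        simp [J]
      rw [hJ, collapse_eq_self κp κm hp hm y.2.1 y.2.2]
    refine Homotopic.trans (g := K.curry 1) ⟨⟨K, hK0, fun y => rfl⟩⟩
      ⟨⟨J, fun y => (hKJ y).symm, hJ1⟩⟩
  · -- The homotopy `M` replaces `e (e⁻¹ v)` by `v` itself, for `v` in the unit sphere. The result is
    -- joined to the identity by segments because it keeps the sign of the last component.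
    let d : C(W, ℝ) := ⟨fun w => 1 - |clip (T w)|, by
      have := continuous_clip; fun_prop⟩
    have hd0 : ∀ w, 0 ≤ d w := fun w => sub_nonneg.2 (abs_clip_le _)
    have hdT : ∀ w, d w ≠ 0 → |T w| < 1 := fun w h =>
      abs_clip_lt_iff.1 (sub_pos.1 ((hd0 w).lt_of_ne' h))
    have hdv : ∀ w : W, d w ≠ 0 → w.1.1 ≠ 0 := fun w h =>
      hTv w ((hdT w h).trans (by norm_num))
    obtain ⟨K, hK1, hK2⟩ := exists_smul_extension (d.comp (ContinuousMap.snd : C(I × W, W)))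
      ⟨fun z => Hr (z.1.1, N.toFun ⟨z.1.2.1.1, hdv z.1.2 z.2⟩), by fun_prop⟩
    have hK0 : ∀ z : I × W, (K z, clip (T z.2)) ∈ W := fun z h => by
      have h1 : K z = 0 := congrArg Prod.fst h
      have h2 : clip (T z.2) = 0 := congrArg Prod.snd h
      have h3 : d z.2 = 1 := by simp [d, h2]
      have h4 : (d.comp (ContinuousMap.snd : C(I × W, W))) z ≠ 0 := by
        change d z.2 ≠ 0
        rw [h3]; norm_num
      have h5 := congrArg norm ((hK1 z h4).symm.trans h1)
      simp [h3] at h5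
    let M : C(I × W, W) := ⟨fun z => ⟨(K z, clip (T z.2)), hK0 z⟩, by
      have := continuous_clip; fun_prop⟩
    refine Homotopic.trans (g := M.curry 1) ⟨⟨M, fun w => ?_, fun w => rfl⟩⟩
      (homotopic_of_segment_subset _ _ fun w u h0 h1 => ?_)
    · ext1
      change (K (0, w), clip (T w)) = (φ (G w), (G w : E × ℝ).2)
      have hcd : c (G w) = d w := by
        change 1 - |(G w : E × ℝ).2| = 1 - |clip (T w)|
        rw [hGs]
      rw [hGs]
      congr 1
      by_cases h : d w = 0
      · rw [hK2 (0, w) h, hφ2 (G w) (hcd.trans h)]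
      · rw [hK1 (0, w) h, hφ1 (G w) (by rwa [hcd])]
        have hT3 : |T w| < 3 := (hdT w h).trans (by norm_num)
        have hGU : (G w : E × ℝ).1 = e.invFun (N.toFun ⟨w.1.1, hTv w hT3⟩) :=
          congrArg Prod.fst ((hG1 w hT3).trans (collapse_eq_self κp κm hp hm
            (mem_longCylinder hp hm (e.invFun _).2 _) (hdT w h).le))
        refine congrArg₂ (· • ·) hcd.symm (congrArg Subtype.val ?_)
        refine (Hr.apply_zero _).trans (congrArg e.toFun (Subtype.ext ?_))
        exact hGU.symm
    · change (1 - u) • (K (1, w), clip (T w)) + u • (w : V × ℝ) ≠ 0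
      intro h
      have h2 : (1 - u) * clip (T w) + u * w.1.2 = 0 := congrArg Prod.snd h
      have h3 : (1 - u) • K (1, w) + u • w.1.1 = 0 := congrArg Prod.fst h
      have hsgn : 0 ≤ clip (T w) * w.1.2 := clip_mul_nonneg (slope_mul_nonneg _)
      have hz : clip (T w) = 0 ↔ w.1.2 = 0 := clip_eq_zero_iff.trans (slope_eq_zero_iff w.2)
      by_cases hη : w.1.2 = 0
      · have hcl := hz.2 hη
        have hd1 : d w = 1 := by simp [d, hcl]
        have hv : w.1.1 ≠ 0 := hdv w (by rw [hd1]; norm_num)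
        have hKv : K (1, w) = ‖w.1.1‖⁻¹ • w.1.1 := by
          rw [hK1 (1, w) (by change d w ≠ 0; rw [hd1]; norm_num)]
          refine (congrArg₂ (· • ·) hd1 (congrArg Subtype.val (Hr.apply_one _))).trans ?_
          exact one_smul _ _
        refine segment_ne_zero hv (inv_pos.2 (norm_pos_iff.2 hv)) (u := 1 - u)
          (by linarith) (by linarith) ?_
        rw [hKv] at h3
        rw [← h3, sub_sub_cancel, add_comm]
      · have hcl : clip (T w) ≠ 0 := fun h => hη (hz.1 h)
        have h4 : 0 < clip (T w) * w.1.2 := hsgn.lt_of_ne' (mul_ne_zero hcl hη)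
        have h5 : 0 < w.1.2 * w.1.2 := mul_self_pos.2 hη
        have h6 : (1 - u) * (clip (T w) * w.1.2) + u * (w.1.2 * w.1.2) = 0 := by
          linear_combination w.1.2 * h2
        rcases h0.eq_or_lt with rfl | h0
        · linarith
        · nlinarith [mul_nonneg (sub_nonneg.2 h1) h4.le, mul_pos h0 h5]

end Suspension

/-! ### Maxima of minima over gapped sets -/

/-- `phi g k n x` is the maximum of `min_{i ∈ T} x i` over all `k`-subsets `T` of `{1, …, n}` whose
`j`-th and `(j+1)`-st elements, counted from `1`, differ by at least `g j`, truncated to `[-1, 1]`.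
The recursion distinguishes whether `n + 1` is the last element of `T`. For
`-1 < b ≤ 1`, the set `{i | b ≤ x i}` contains such a `T` iff `b ≤ phi g k n x`. -/
noncomputable def phi (g : ℕ → ℕ) : ℕ → ℕ → (ℕ → ℝ) → ℝ
  | 0, _, _ => 1
  | _ + 1, 0, _ => -1
  | k + 1, n + 1, x => max (phi g (k + 1) n x) (min (phi g k (n + 1 - g k) x) (x (n + 1)))
  termination_by k n => (k, n)

section Phi

variable {g : ℕ → ℕ}

theorem phi_zero (n : ℕ) (x : ℕ → ℝ) : phi g 0 n x = 1 := by rw [phi]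

theorem phi_succ_zero (k : ℕ) (x : ℕ → ℝ) : phi g (k + 1) 0 x = -1 := by rw [phi]

theorem phi_succ_succ (k n : ℕ) (x : ℕ → ℝ) : phi g (k + 1) (n + 1) x =
    max (phi g (k + 1) n x) (min (phi g k (n + 1 - g k) x) (x (n + 1))) := by rw [phi]

@[fun_prop]
theorem continuous_phi (k n : ℕ) : Continuous (phi g k n) := by
  induction k generalizing n with
  | zero => simpa only [funext (phi_zero n)] using continuous_const
  | succ k ih =>
    induction n with
    | zero => simpa only [funext (phi_succ_zero k)] using continuous_const
    | succ n ihn =>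
      rw [funext (phi_succ_succ k n)]
      have := ih (n + 1 - g k)
      fun_prop

theorem phi_le_one (k n : ℕ) (x : ℕ → ℝ) : phi g k n x ≤ 1 := by
  induction k generalizing n with
  | zero => rw [phi_zero]
  | succ k ih =>
    induction n with
    | zero => rw [phi_succ_zero]; norm_num
    | succ n ihn =>
      rw [phi_succ_succ]
      exact max_le ihn ((min_le_left _ _).trans (ih _))

theorem phi_mono_right (k : ℕ) {n m : ℕ} (h : n ≤ m) (x : ℕ → ℝ) : phi g k n x ≤ phi g k m x := by
  cases k with
  | zero => rw [phi_zero, phi_zero]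
  | succ k =>
    induction h with
    | refl => rfl
    | step h ih => rw [phi_succ_succ]; exact ih.trans (le_max_left _ _)

theorem neg_one_le_phi (k n : ℕ) (x : ℕ → ℝ) : -1 ≤ phi g k n x := by
  cases k with
  | zero => rw [phi_zero]; norm_num
  | succ k => rw [← phi_succ_zero (g := g) k x]; exact phi_mono_right _ (Nat.zero_le _) x

theorem phi_mono (k n : ℕ) {x y : ℕ → ℝ} (h : ∀ i, x i ≤ y i) : phi g k n x ≤ phi g k n y := by
  induction k generalizing n with
  | zero => rw [phi_zero, phi_zero]
  | succ k ih =>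
    induction n with
    | zero => rw [phi_succ_zero, phi_succ_zero]
    | succ n ihn =>
      rw [phi_succ_succ, phi_succ_succ]
      exact max_le_max ihn (min_le_min (ih _) (h _))

theorem phi_succ_le (k n : ℕ) (x : ℕ → ℝ) : phi g (k + 1) n x ≤ phi g k (n - g k) x := by
  induction n with
  | zero => rw [phi_succ_zero]; exact neg_one_le_phi _ _ _
  | succ n ih =>
    rw [phi_succ_succ]
    exact max_le (ih.trans (phi_mono_right _ (by omega) x)) (min_le_left _ _)

theorem phi_congr (k n : ℕ) {x y : ℕ → ℝ} (h : ∀ i ≤ n, x i = y i) :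
    phi g k n x = phi g k n y := by
  induction k generalizing n with
  | zero => rw [phi_zero, phi_zero]
  | succ k ih =>
    induction n with
    | zero => rw [phi_succ_zero, phi_succ_zero]
    | succ n ihn =>
      rw [phi_succ_succ, phi_succ_succ, ihn fun i hi => h i (by omega),
        ih _ fun i hi => h i (by omega), h (n + 1) le_rfl]

theorem phi_update (k : ℕ) {n m : ℕ} (h : n < m) (x : ℕ → ℝ) (v : ℝ) :
    phi g k n (Function.update x m v) = phi g k n x :=
  phi_congr _ _ fun i hi => Function.update_of_ne (by omega) _ _

theorem neg_update (x : ℕ → ℝ) (m : ℕ) (v : ℝ) :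
    -Function.update x m v = Function.update (-x) m (-v) := by
  ext i
  by_cases h : i = m
  · subst h; simp
  · simp [h]

theorem phi_neg_update (k : ℕ) {n m : ℕ} (h : n < m) (x : ℕ → ℝ) (v : ℝ) :
    phi g k n (-Function.update x m v) = phi g k n (-x) := by
  rw [neg_update, phi_update k h]

theorem segment_update (x : ℕ → ℝ) (m : ℕ) (a b u : ℝ) :
    (1 - u) • Function.update x m a + u • Function.update x m b =
      Function.update x m ((1 - u) * a + u * b) := by
  ext i
  by_cases h : i = m
  · subst h; simp
  · simp [h]; ring

theorem segment_update_self (x : ℕ → ℝ) (m : ℕ) (a u : ℝ) :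
    (1 - u) • Function.update x m a + u • x =
      Function.update x m ((1 - u) * a + u * x m) := by
  simpa using segment_update x m a (x m) u

/-- The vectors `x` for which some threshold lies below the values of `x` on a gapped `i`-subset of
`{1, …, a}` and above the values of `x` on a gapped `j`-subset of `{1, …, b}`. The threshold ranges
over the interval from `-phi g j b (-x)` to `phi g i a x`. -/
def pairSet (g : ℕ → ℕ) (i a j b : ℕ) : Set (ℕ → ℝ) := {x | 0 < phi g i a x + phi g j b (-x)}

theorem mem_pairSet {i a j b : ℕ} {x : ℕ → ℝ} :
    x ∈ pairSet g i a j b ↔ 0 < phi g i a x + phi g j b (-x) := Iff.rfl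

/-- Exchanging the two conditions corresponds to `x ↦ -x`. -/
theorem pairSet_swap (i a j b : ℕ) :
    Nonempty (HomotopyEquiv (pairSet g i a j b) (pairSet g j b i a)) := by
  have h : pairSet g i a j b ≃ₜ pairSet g j b i a :=
    (Homeomorph.neg (ℕ → ℝ)).subtype fun x => by
      simp [mem_pairSet, add_comm]
  exact ⟨h.toHomotopyEquiv⟩

/-- Raising the coordinate `n + 1` makes `phi g (k + 1) (n + 1)` as large as its bound
`phi g k (n + 1 - g k)`, so in a condition whose other part does not involve this coordinate the
former may be replaced by the latter. -/
theorem raise_equiv {k : ℕ} (hg : 1 ≤ g k) (n : ℕ) (q : (ℕ → ℝ) → ℝ)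
    (hq : ∀ x v, q (Function.update x (n + 1) v) = q x) :
    Nonempty (HomotopyEquiv {x | 0 < phi g (k + 1) (n + 1) x + q x}
      {x | 0 < phi g k (n + 1 - g k) x + q x}) := by
  have hr : ∀ x : ℕ → ℝ, phi g k (n + 1 - g k) x ≤
      phi g (k + 1) (n + 1) (Function.update x (n + 1) (max 1 (x (n + 1)))) := fun x => by
    rw [phi_succ_succ, phi_update k (by omega)]
    refine le_max_of_le_right (le_min le_rfl ?_)
    rw [Function.update_self]
    exact (phi_le_one _ _ _).trans (le_max_left _ _)
  let S : Set (ℕ → ℝ) := {x | 0 < phi g (k + 1) (n + 1) x + q x}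
  let S' : Set (ℕ → ℝ) := {x | 0 < phi g k (n + 1 - g k) x + q x}
  have hF : ∀ x ∈ S, x ∈ S' := fun x (h1 : (0 : ℝ) < _) => by
    have h2 := phi_succ_le (g := g) k (n + 1) x
    change (0 : ℝ) < _
    linarith
  have hG : ∀ x ∈ S', Function.update x (n + 1) (max 1 (x (n + 1))) ∈ S :=
    fun x (h1 : (0 : ℝ) < _) => by
      have h2 := hr x
      change (0 : ℝ) < _
      rw [hq]
      linarith
  let F : C(S, S') := ⟨fun x => ⟨x, hF x x.2⟩, continuous_subtype_val.subtype_mk _⟩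
  let G : C(S', S) := ⟨fun x => ⟨_, hG x x.2⟩,
    (Continuous.update continuous_subtype_val _ (continuous_const.max
      ((continuous_apply (n + 1)).comp continuous_subtype_val))).subtype_mk _⟩
  refine ⟨⟨F, G, homotopic_of_segment_subset _ _ fun x u h0 h1 => ?_,
    homotopic_of_segment_subset _ _ fun x u h0 h1 => ?_⟩⟩
  · change (1 - u) • Function.update (x : ℕ → ℝ) (n + 1) _ + u • (x : ℕ → ℝ) ∈ S
    rw [segment_update_self]
    change (0 : ℝ) < _
    rw [hq]
    refine lt_of_lt_of_le (show (0 : ℝ) < _ from x.2) (add_le_add_left (phi_mono _ _ fun i => ?_) _)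
    by_cases hi : i = n + 1
    · subst hi
      rw [Function.update_self]
      change _ ≤ (1 - u) * max 1 ((x : ℕ → ℝ) (n + 1)) + u * (x : ℕ → ℝ) (n + 1)
      nlinarith [le_max_right 1 ((x : ℕ → ℝ) (n + 1))]
    · rw [Function.update_of_ne hi]
  · change (1 - u) • Function.update (x : ℕ → ℝ) (n + 1) _ + u • (x : ℕ → ℝ) ∈ S'
    rw [segment_update_self]
    change (0 : ℝ) < _
    rw [hq, phi_update k (show n + 1 - g k < n + 1 by omega)]
    exact x.2

/-- The two conditions defining this set can be weakened alternately by raising and lowering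
coordinates, until nothing is left of them. Since `2 ≤ g k`, the coordinate `n` does not occur in the
second condition and may be raised; after that the largest coordinate occurs in the second condition
only and may be lowered. -/
theorem contractibleSpace_pairSet (hg : ∀ j, 2 ≤ g j) (k n : ℕ)
    (hn : ∑ j ∈ Finset.range k, g (j + 1) + 1 ≤ n) :
    ContractibleSpace (pairSet g (k + 1) n k (n + 1 - g k)) := by
  induction k generalizing n with
  | zero =>
    obtain ⟨n, rfl⟩ : ∃ m, n = m + 1 := ⟨n - 1, by simp at hn; omega⟩
    obtain ⟨e⟩ := raise_equiv (g := g) (k := 0) (by have := hg 0; omega) n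
      (fun x => phi g 0 (n + 1 + 1 - g 0) (-x)) (fun x v => by rw [phi_zero, phi_zero])
    have hu : {x : ℕ → ℝ | 0 < phi g 0 (n + 1 - g 0) x + phi g 0 (n + 1 + 1 - g 0) (-x)} = univ := by
      simp [phi_zero]
    rw [hu] at e
    have := (Homeomorph.Set.univ (ℕ → ℝ)).contractibleSpace
    exact e.contractibleSpace
  | succ k ih =>
    obtain ⟨n, rfl⟩ : ∃ m, n = m + 1 := ⟨n - 1, by omega⟩
    rw [Finset.sum_range_succ] at hn
    obtain ⟨m, hm⟩ : ∃ m, m = n + 1 - g (k + 1) := ⟨_, rfl⟩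
    have h2 := hg (k + 1)
    have hm' : n + 1 + 1 - g (k + 1) = m + 1 := by omega
    have := ih m (by omega)
    obtain ⟨e⟩ := raise_equiv (g := g) (k := k + 1) (by omega) n
      (fun x => phi g (k + 1) (m + 1) (-x)) (fun x v => phi_neg_update _ (by omega) x v)
    obtain ⟨e'⟩ := raise_equiv (g := g) (k := k) (by have := hg k; omega) m
      (fun x => phi g (k + 1) m (-x)) (fun x v => phi_neg_update _ (by omega) x v)
    rw [← hm] at e
    obtain ⟨s⟩ := pairSet_swap (g := g) (k + 1) m (k + 1) (m + 1)
    obtain ⟨s'⟩ := pairSet_swap (g := g) k (m + 1 - g k) (k + 1) m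
    rw [hm']
    exact (((e.trans s).trans e').trans s').contractibleSpace

end Phi

/-! ### Adding a coordinate -/

section Induction

variable {g : ℕ → ℕ}

/-- Twice the height of the coordinate `x (n + 1)` above the middle of the interval from
`-phi g (k + 1) n (-x)` to `phi g (k + 1) n x`. -/
noncomputable def crossHeight (g : ℕ → ℕ) (k n : ℕ) (x : ℕ → ℝ) : ℝ :=
  2 * x (n + 1) - phi g (k + 1) n x + phi g (k + 1) n (-x)

/-- The signed length of the interval from `-phi g (k + 1) n (-x)` to `phi g (k + 1) n x`; it is
positive iff `x ∈ pairSet g (k + 1) n (k + 1) n`. -/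
noncomputable def crossGap (g : ℕ → ℕ) (k n : ℕ) (x : ℕ → ℝ) : ℝ :=
  phi g (k + 1) n x + phi g (k + 1) n (-x)

/-- The height of the coordinate `x (n + 1)`, normalized to `[-1, 1]` and so that it is `±1` outside
`pairSet g (k + 1) n (k + 1) n`. -/
noncomputable def crossParam (g : ℕ → ℕ) (k n : ℕ) (x : ℕ → ℝ) : ℝ :=
  crossHeight g k n x / max (crossGap g k n x) |crossHeight g k n x|

/-- The vector `x` with its coordinate at `n + 1` moved to a height prescribed by `t`. For `t = ±1` it
lies outside the interval from `-phi g (k + 1) n (-x)` to `phi g (k + 1) n x`, in either orientation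
of the latter. -/
noncomputable def crossLift (g : ℕ → ℕ) (k n : ℕ) (x : ℕ → ℝ) (t : ℝ) : ℕ → ℝ :=
  Function.update x (n + 1) ((phi g (k + 1) n x - phi g (k + 1) n (-x)) / 2 +
    t * (1 + |crossGap g k n x|))

theorem crossGap_update (k n : ℕ) (x : ℕ → ℝ) (v : ℝ) :
    crossGap g k n (Function.update x (n + 1) v) = crossGap g k n x := by
  rw [crossGap, phi_update _ (Nat.lt_succ_self n), phi_neg_update _ (Nat.lt_succ_self n)]; rfl

theorem crossGap_pos_iff {k n : ℕ} {x : ℕ → ℝ} :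
    0 < crossGap g k n x ↔ x ∈ pairSet g (k + 1) n (k + 1) n := Iff.rfl

theorem crossHeight_crossLift (k n : ℕ) (x : ℕ → ℝ) (t : ℝ) :
    crossHeight g k n (crossLift g k n x t) = 2 * (t * (1 + |crossGap g k n x|)) := by
  rw [crossHeight, crossLift, phi_update _ (Nat.lt_succ_self n),
    phi_neg_update _ (Nat.lt_succ_self n), Function.update_self]
  ring

variable (hg : ∀ j, 2 ≤ g j)
include hg

theorem mem_pairSet_update_iff {k n : ℕ} {x : ℕ → ℝ} (v : ℝ) :
    Function.update x (n + 1) v ∈ pairSet g (k + 1) (n + 1) (k + 1) (n + 1) ↔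
      0 < max (phi g (k + 1) n x) (min (phi g k (n + 1 - g k) x) v) +
        max (phi g (k + 1) n (-x)) (min (phi g k (n + 1 - g k) (-x)) (-v)) := by
  have := hg k
  rw [mem_pairSet, phi_succ_succ, phi_succ_succ, phi_update _ (Nat.lt_succ_self n),
    phi_update _ (by omega), phi_neg_update _ (Nat.lt_succ_self n), phi_neg_update _ (by omega),
    Function.update_self, neg_update, Function.update_self]

theorem update_mem_of_gap {k n : ℕ} {x : ℕ → ℝ} (h : 0 < crossGap g k n x) (v : ℝ) :
    Function.update x (n + 1) v ∈ pairSet g (k + 1) (n + 1) (k + 1) (n + 1) := by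
  rw [mem_pairSet_update_iff hg]
  exact h.trans_le (add_le_add (le_max_left _ _) (le_max_left _ _))

theorem update_mem_of_right {k n : ℕ} {x : ℕ → ℝ} {v : ℝ}
    (h : x ∈ pairSet g k (n + 1 - g k) (k + 1) n) (hv : 0 < v + phi g (k + 1) n (-x)) :
    Function.update x (n + 1) v ∈ pairSet g (k + 1) (n + 1) (k + 1) (n + 1) := by
  rw [mem_pairSet_update_iff hg]
  rw [mem_pairSet] at h
  refine lt_of_lt_of_le ?_ (add_le_add (le_max_right _ _) (le_max_left _ _))
  rcases min_choice (phi g k (n + 1 - g k) x) v with h1 | h1 <;> rw [h1] <;> assumption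

theorem update_mem_of_left {k n : ℕ} {x : ℕ → ℝ} {v : ℝ}
    (h : x ∈ pairSet g (k + 1) n k (n + 1 - g k)) (hv : 0 < phi g (k + 1) n x - v) :
    Function.update x (n + 1) v ∈ pairSet g (k + 1) (n + 1) (k + 1) (n + 1) := by
  rw [mem_pairSet_update_iff hg]
  rw [mem_pairSet] at h
  refine lt_of_lt_of_le ?_ (add_le_add (le_max_left _ _) (le_max_right _ _))
  rcases min_choice (phi g k (n + 1 - g k) (-x)) (-v) with h1 | h1 <;> rw [h1] <;> linarith

omit hg in
/-- An element of the larger set that does not come from the smaller one has its last coordinate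
either above both of the extremal thresholds of the other coordinates, or below both. -/
theorem cross_cases {k n : ℕ} {x : ℕ → ℝ} (h : x ∈ pairSet g (k + 1) (n + 1) (k + 1) (n + 1))
    (h0 : crossGap g k n x ≤ 0) :
    (0 < crossHeight g k n x ∧ 0 < x (n + 1) + phi g (k + 1) n (-x) ∧
        x ∈ pairSet g k (n + 1 - g k) (k + 1) n) ∨
      (crossHeight g k n x < 0 ∧ 0 < phi g (k + 1) n x - x (n + 1) ∧
        x ∈ pairSet g (k + 1) n k (n + 1 - g k)) := by
  rw [mem_pairSet, phi_succ_succ, phi_succ_succ] at h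
  simp only [crossGap, crossHeight, mem_pairSet, Pi.neg_apply] at *
  have h1 := min_le_left (phi g k (n + 1 - g k) x) (x (n + 1))
  have h2 := min_le_right (phi g k (n + 1 - g k) x) (x (n + 1))
  have h3 := min_le_left (phi g k (n + 1 - g k) (-x)) (-x (n + 1))
  have h4 := min_le_right (phi g k (n + 1 - g k) (-x)) (-x (n + 1))
  rcases max_choice (phi g (k + 1) n x) (min (phi g k (n + 1 - g k) x) (x (n + 1))) with h5 | h5 <;>
  rcases max_choice (phi g (k + 1) n (-x))
    (min (phi g k (n + 1 - g k) (-x)) (-x (n + 1))) with h6 | h6 <;> rw [h5, h6] at h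
  · linarith
  · right; refine ⟨?_, ?_, ?_⟩ <;> linarith
  · left; refine ⟨?_, ?_, ?_⟩ <;> linarith
  · linarith

omit hg in
theorem pairSet_subset_right (k n : ℕ) :
    pairSet g (k + 1) n (k + 1) n ⊆ pairSet g k (n + 1 - g k) (k + 1) n := fun x h => by
  rw [mem_pairSet] at h ⊢
  have h1 := phi_succ_le (g := g) k n x
  have h2 := phi_mono_right (g := g) k (show n - g k ≤ n + 1 - g k by omega) x
  linarith

omit hg in
theorem pairSet_subset_left (k n : ℕ) :
    pairSet g (k + 1) n (k + 1) n ⊆ pairSet g (k + 1) n k (n + 1 - g k) := fun x h => by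
  rw [mem_pairSet] at h ⊢
  have h1 := phi_succ_le (g := g) k n (-x)
  have h2 := phi_mono_right (g := g) k (show n - g k ≤ n + 1 - g k by omega) (-x)
  linarith

omit hg in
theorem cross_denom_pos {k n : ℕ} {x : ℕ → ℝ}
    (h : x ∈ pairSet g (k + 1) (n + 1) (k + 1) (n + 1)) :
    0 < max (crossGap g k n x) |crossHeight g k n x| := by
  by_cases h0 : 0 < crossGap g k n x
  · exact lt_max_of_lt_left h0
  · rcases cross_cases h (not_lt.1 h0) with h1 | h1
    · exact lt_max_of_lt_right (abs_pos.2 h1.1.ne')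
    · exact lt_max_of_lt_right (abs_pos.2 h1.1.ne)

omit hg in
theorem crossParam_of_pos {k n : ℕ} {x : ℕ → ℝ} (h0 : crossGap g k n x ≤ 0)
    (h : 0 < crossHeight g k n x) : crossParam g k n x = 1 := by
  rw [crossParam, abs_of_pos h, max_eq_right (h0.trans h.le), div_self h.ne']

omit hg in
theorem crossParam_of_neg {k n : ℕ} {x : ℕ → ℝ} (h0 : crossGap g k n x ≤ 0)
    (h : crossHeight g k n x < 0) : crossParam g k n x = -1 := by
  rw [crossParam, abs_of_neg h, max_eq_right (by linarith), div_neg, div_self h.ne]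

omit hg in
theorem abs_crossParam_le (k n : ℕ) (x : ℕ → ℝ) : |crossParam g k n x| ≤ 1 := by
  have : 0 ≤ max (crossGap g k n x) |crossHeight g k n x| :=
    (abs_nonneg _).trans (le_max_right _ _)
  rw [crossParam, abs_div, abs_of_nonneg this]
  exact div_le_one_of_le₀ (le_max_right _ _) this

theorem update_mem_right_iff {k n : ℕ} {x : ℕ → ℝ} (v : ℝ) :
    Function.update x (n + 1) v ∈ pairSet g k (n + 1 - g k) (k + 1) n ↔
      x ∈ pairSet g k (n + 1 - g k) (k + 1) n := by
  have := hg k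
  rw [mem_pairSet, mem_pairSet, phi_update _ (by omega), phi_neg_update _ (by omega)]

theorem update_mem_left_iff {k n : ℕ} {x : ℕ → ℝ} (v : ℝ) :
    Function.update x (n + 1) v ∈ pairSet g (k + 1) n k (n + 1 - g k) ↔
      x ∈ pairSet g (k + 1) n k (n + 1 - g k) := by
  have := hg k
  rw [mem_pairSet, mem_pairSet, phi_update _ (by omega), phi_neg_update _ (by omega)]

omit hg in
theorem segment_add_pos {a y b u : ℝ} (h0 : 0 ≤ u) (h1 : u ≤ 1) (ha : 0 < a + b)
    (hy : 0 < y + b) : 0 < (1 - u) * a + u * y + b := by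
  rcases h0.eq_or_lt with rfl | h0
  · linarith
  · nlinarith [mul_pos h0 hy, mul_nonneg (sub_nonneg.2 h1) ha.le]

/-- Passing from `n` to `n + 1` is a suspension: a vector either is separated by its first `n`
coordinates, and then its last coordinate is arbitrary, or its last coordinate is high, or it is
low. -/
theorem pairSet_succ_equiv (k n : ℕ) :
    Nonempty (HomotopyEquiv (pairSet g (k + 1) (n + 1) (k + 1) (n + 1))
      (mappingCylinder (pairSet g (k + 1) n (k + 1) n) (pairSet g k (n + 1 - g k) (k + 1) n)
        (pairSet g (k + 1) n k (n + 1 - g k)))) := by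
  let U := pairSet g (k + 1) n (k + 1) n
  let Zp := pairSet g k (n + 1 - g k) (k + 1) n
  let Zm := pairSet g (k + 1) n k (n + 1 - g k)
  let X := pairSet g (k + 1) (n + 1) (k + 1) (n + 1)
  have hp : U ⊆ Zp := pairSet_subset_right k n
  have hm : U ⊆ Zm := pairSet_subset_left k n
  have hF : ∀ x ∈ X, (x, crossParam g k n x) ∈ mappingCylinder U Zp Zm := fun x hx => by
    by_cases h0 : 0 < crossGap g k n x
    · exact ⟨mem_longCylinder hp hm h0 _, abs_crossParam_le k n x⟩
    · rcases cross_cases hx (not_lt.1 h0) with h1 | h1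
      · rw [crossParam_of_pos (not_lt.1 h0) h1.1]
        exact right_mem_mappingCylinder h1.2.2
      · rw [crossParam_of_neg (not_lt.1 h0) h1.1]
        exact left_mem_mappingCylinder h1.2.2
  have hcases : ∀ q ∈ mappingCylinder U Zp Zm, ¬ 0 < crossGap g k n q.1 →
      (q.2 = 1 ∧ q.1 ∈ Zp) ∨ (q.2 = -1 ∧ q.1 ∈ Zm) := fun q hq h0 => by
    have h1 : ¬ |q.2| < 1 := fun h => h0 (hq.1.1 h)
    have h2 := abs_le.1 hq.2
    rcases le_abs.1 (not_lt.1 h1) with h3 | h3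
    · exact Or.inl ⟨le_antisymm h2.2 h3, hq.1.2.1 h3⟩
    · exact Or.inr ⟨le_antisymm (by linarith) h2.1, hq.1.2.2 (by linarith)⟩
  have hG : ∀ q ∈ mappingCylinder U Zp Zm, crossLift g k n q.1 q.2 ∈ X := fun q hq => by
    by_cases h0 : 0 < crossGap g k n q.1
    · exact update_mem_of_gap hg h0 _
    · have hgap := neg_abs_le (crossGap g k n q.1)
      rcases hcases q hq h0 with ⟨ht, hx⟩ | ⟨ht, hx⟩
      · refine update_mem_of_right hg hx ?_
        rw [ht]
        simp only [crossGap] at *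
        linarith
      · refine update_mem_of_left hg hx ?_
        rw [ht]
        simp only [crossGap] at *
        linarith
  have cH : Continuous (crossHeight g k n) := by
    unfold crossHeight; fun_prop
  have cG : Continuous (crossGap g k n) := by
    unfold crossGap; fun_prop
  let F : C(X, mappingCylinder U Zp Zm) := ⟨fun x => ⟨(x, crossParam g k n x), hF x x.2⟩, by
    refine (continuous_subtype_val.prodMk ?_).subtype_mk _
    exact Continuous.div (by fun_prop) (by fun_prop) fun x => (cross_denom_pos x.2).ne'⟩
  let G : C(mappingCylinder U Zp Zm, X) :=
    ⟨fun q => ⟨crossLift g k n q.1.1 q.1.2, hG q q.2⟩, by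
      refine Continuous.subtype_mk ?_ _
      unfold crossLift
      fun_prop⟩
  refine ⟨⟨F, G, homotopic_of_segment_subset _ _ fun x u hu0 hu1 => ?_,
    homotopic_of_segment_subset _ _ fun q u hu0 hu1 => ?_⟩⟩
  · change (1 - u) • crossLift g k n x (crossParam g k n x) + u • (x : ℕ → ℝ) ∈ X
    rw [crossLift, segment_update_self]
    by_cases h0 : 0 < crossGap g k n x
    · exact update_mem_of_gap hg h0 _
    · have hgap := neg_abs_le (crossGap g k n x)
      rcases cross_cases x.2 (not_lt.1 h0) with ⟨h1, h3, h2⟩ | ⟨h1, h3, h2⟩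
      · refine update_mem_of_right hg h2 ?_
        rw [crossParam_of_pos (not_lt.1 h0) h1]
        simp only [crossGap] at *
        exact segment_add_pos hu0 hu1 (by linarith) h3
      · refine update_mem_of_left hg h2 ?_
        rw [crossParam_of_neg (not_lt.1 h0) h1]
        simp only [crossGap] at *
        have := segment_add_pos (a := -((phi g (k + 1) n x - phi g (k + 1) n (-x)) / 2 +
          -1 * (1 + |phi g (k + 1) n x + phi g (k + 1) n (-x)|))) (y := -(x : ℕ → ℝ) (n + 1))
          (b := phi g (k + 1) n x) hu0 hu1 (by linarith) (by linarith)
        linarith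
  · have hsplit : (1 - u) • ((F (G q) : (ℕ → ℝ) × ℝ)) + u • (q : (ℕ → ℝ) × ℝ) =
        ((1 - u) • crossLift g k n q.1.1 q.1.2 + u • q.1.1,
          (1 - u) * crossParam g k n (crossLift g k n q.1.1 q.1.2) + u * q.1.2) := rfl
    change (1 - u) • ((F (G q) : (ℕ → ℝ) × ℝ)) + u • (q : (ℕ → ℝ) × ℝ) ∈ _
    rw [hsplit]
    set t' := crossParam g k n (crossLift g k n q.1.1 q.1.2) with ht'
    have hgap' : crossGap g k n (crossLift g k n q.1.1 q.1.2) = crossGap g k n q.1.1 :=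
      crossGap_update k n _ _
    rw [crossLift, segment_update_self]
    have habs := abs_nonneg (crossGap g k n q.1.1)
    by_cases h0 : 0 < crossGap g k n q.1.1
    · refine ⟨mem_longCylinder hp hm ?_ _, ?_⟩
      · rw [← crossGap_pos_iff, crossGap_update]
        exact h0
      · have h1 := abs_le.1 (abs_crossParam_le (g := g) k n (crossLift g k n q.1.1 q.1.2))
        have h2 := abs_le.1 q.2.2
        rw [← ht'] at h1
        exact abs_le.2 ⟨by simp only; nlinarith, by simp only; nlinarith⟩
    · rcases hcases q q.2 h0 with ⟨h1, h2⟩ | ⟨h1, h2⟩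
      · have h3 : t' = 1 := crossParam_of_pos (by rw [hgap']; exact not_lt.1 h0) (by
          rw [crossHeight_crossLift, h1]; linarith)
        rw [h3, h1, show (1 - u) * 1 + u * 1 = 1 by ring]
        exact right_mem_mappingCylinder ((update_mem_right_iff hg _).2 h2)
      · have h3 : t' = -1 := crossParam_of_neg (by rw [hgap']; exact not_lt.1 h0) (by
          rw [crossHeight_crossLift, h1]; linarith)
        rw [h3, h1, show (1 - u) * (-1) + u * (-1) = -1 by ring]
        exact left_mem_mappingCylinder ((update_mem_left_iff hg _).2 h2)

omit hg in
/-- A gapped `(k + 1)`-subset spans more than the sum of the gaps. -/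
theorem phi_eq_neg_one (k n : ℕ) (x : ℕ → ℝ) (hn : n ≤ ∑ j ∈ Finset.range k, g (j + 1)) :
    phi g (k + 1) n x = -1 := by
  induction k generalizing n with
  | zero =>
    obtain rfl : n = 0 := by simpa using hn
    rw [phi_succ_zero]
  | succ k ih =>
    refine le_antisymm ?_ (neg_one_le_phi _ _ _)
    rw [Finset.sum_range_succ] at hn
    rw [← ih (n - g (k + 1)) (by omega)]
    exact phi_succ_le (k + 1) n x

omit hg in
/-- For the smallest `n` that admits a gapped `(k + 1)`-subset, this subset is unique. -/
theorem pairSet_eq_empty (k : ℕ) :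
    pairSet g (k + 1) (∑ j ∈ Finset.range k, g (j + 1) + 1) (k + 1)
      (∑ j ∈ Finset.range k, g (j + 1) + 1) = ∅ := by
  have key : ∀ x : ℕ → ℝ, phi g (k + 1) (∑ j ∈ Finset.range k, g (j + 1) + 1) x ≤
      max (-1) (x (∑ j ∈ Finset.range k, g (j + 1) + 1)) := fun x => by
    rw [phi_succ_succ, phi_eq_neg_one k _ x le_rfl]
    exact max_le_max le_rfl (min_le_right _ _)
  refine eq_empty_of_forall_notMem fun x hx => ?_
  rw [mem_pairSet] at hx
  have h1 := key x
  have h2 := key (-x)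
  have h3 := phi_le_one (g := g) (k + 1) (∑ j ∈ Finset.range k, g (j + 1) + 1) x
  have h4 := phi_le_one (g := g) (k + 1) (∑ j ∈ Finset.range k, g (j + 1) + 1) (-x)
  rw [Pi.neg_apply] at h2
  rcases le_max_iff.1 h1 with h1 | h1 <;> rcases le_max_iff.1 h2 with h2 | h2 <;> linarith

/-- The separated vectors form a homotopy sphere. For the smallest `n` the set is empty, which is
the unit sphere of a space of dimension zero. -/
theorem pairSet_equiv_sphere (k d : ℕ) :
    Nonempty (HomotopyEquiv
      (pairSet g (k + 1) (∑ j ∈ Finset.range k, g (j + 1) + 1 + d) (k + 1)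
        (∑ j ∈ Finset.range k, g (j + 1) + 1 + d))
      (sphere (0 : EuclideanSpace ℝ (Fin d)) 1)) := by
  induction d with
  | zero =>
    have h1 : IsEmpty (pairSet g (k + 1) (∑ j ∈ Finset.range k, g (j + 1) + 1 + 0) (k + 1)
        (∑ j ∈ Finset.range k, g (j + 1) + 1 + 0)) := by
      rw [add_zero, pairSet_eq_empty]; infer_instance
    have h2 : IsEmpty (sphere (0 : EuclideanSpace ℝ (Fin 0)) 1) :=
      ⟨fun v => by
        have h := norm_eq_of_mem_sphere v
        rw [Subsingleton.elim (v : EuclideanSpace ℝ (Fin 0)) 0, norm_zero] at h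
        exact zero_ne_one h⟩
    exact ⟨(Homeomorph.empty).toHomotopyEquiv⟩
  | succ d ih =>
    obtain ⟨e⟩ := ih
    set n := ∑ j ∈ Finset.range k, g (j + 1) + 1 + d with hn
    have hZm := contractibleSpace_pairSet hg k n (by omega)
    obtain ⟨s⟩ := pairSet_swap (g := g) k (n + 1 - g k) (k + 1) n
    obtain ⟨e1⟩ := pairSet_succ_equiv hg k n
    obtain ⟨e2⟩ := mappingCylinder_equiv_punctured (pairSet_subset_right k n)
      (pairSet_subset_left k n) s.contractibleSpace hZm e
    have hfr : Module.finrank ℝ (EuclideanSpace ℝ (Fin d) × ℝ) =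
        Module.finrank ℝ (EuclideanSpace ℝ (Fin (d + 1))) := by simp
    obtain ⟨e3⟩ := punctured_equiv_sphere_of_linearEquiv (ContinuousLinearEquiv.ofFinrankEq hfr)
    exact ⟨(e1.trans e2).trans e3⟩

end Induction

/-! ### Stable sets and superlevel sets -/

section Threshold

variable {g : ℕ → ℕ}

theorem le_phi {b : ℝ} (hb : b ≤ 1) {x : ℕ → ℝ} (k n : ℕ) (t : ℕ → ℕ)
    (h1 : ∀ j < k, 1 ≤ t j ∧ t j ≤ n ∧ b ≤ x (t j))
    (h2 : ∀ j, j + 1 < k → t j + g (j + 1) ≤ t (j + 1)) : b ≤ phi g k n x := by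
  induction k generalizing n with
  | zero => rwa [phi_zero]
  | succ k ih =>
    obtain ⟨L, hL⟩ : ∃ L, t k = L + 1 := ⟨t k - 1, by have := (h1 k (by omega)).1; omega⟩
    have hk := h1 k (by omega)
    rw [hL] at hk
    refine le_trans ?_ (phi_mono_right _ hk.2.1 x)
    rw [phi_succ_succ]
    refine le_max_of_le_right (le_min (ih _ (fun j hj => ?_) fun j hj => h2 j (by omega)) hk.2.2)
    have hj1 := h1 j (by omega)
    refine ⟨hj1.1, ?_, hj1.2.2⟩
    have hmono : ∀ m, j ≤ m → m < k → t j ≤ t m := by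
      intro m hm
      induction m, hm using Nat.le_induction with
      | base => exact fun _ => le_rfl
      | succ m _ ihm =>
        intro hmk
        have := ihm (by omega)
        have := h2 m (by omega)
        omega
    obtain ⟨m, rfl⟩ : ∃ m, k = m + 1 := ⟨k - 1, by omega⟩
    have h3 := hmono m (by omega) (by omega)
    have h4 := h2 m (by omega)
    omega

theorem exists_of_le_phi {b : ℝ} (hb : -1 < b) {x : ℕ → ℝ} (k n : ℕ) (h : b ≤ phi g k n x) :
    ∃ t : ℕ → ℕ, (∀ j < k, 1 ≤ t j ∧ t j ≤ n ∧ b ≤ x (t j)) ∧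
      ∀ j, j + 1 < k → t j + g (j + 1) ≤ t (j + 1) := by
  induction k generalizing n with
  | zero => exact ⟨fun _ => 0, fun j hj => by omega, fun j hj => by omega⟩
  | succ k ih =>
    induction n with
    | zero => rw [phi_succ_zero] at h; linarith
    | succ n ihn =>
      rw [phi_succ_succ, le_max_iff, le_min_iff] at h
      rcases h with h | ⟨h, hx⟩
      · obtain ⟨t, h1, h2⟩ := ihn h
        exact ⟨t, fun j hj => ⟨(h1 j hj).1, (h1 j hj).2.1.trans (by omega), (h1 j hj).2.2⟩, h2⟩
      · obtain ⟨t, h1, h2⟩ := ih _ h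
        refine ⟨fun j => if j < k then t j else n + 1, fun j hj => ?_, fun j hj => ?_⟩
        · by_cases hjk : j < k
          · have := h1 j hjk
            simp only [hjk, if_true]
            exact ⟨this.1, by omega, this.2.2⟩
          · simp only [hjk, if_false]
            exact ⟨by omega, le_rfl, hx⟩
        · by_cases hjk : j + 1 < k
          · simp only [hjk, show j < k by omega, if_true]
            exact h2 j hjk
          · obtain rfl : k = j + 1 := by omega
            simp only [show j < j + 1 by omega, lt_irrefl, if_true, if_false]
            have := h1 j (by omega)
            omega

/-- The gaps prescribed by the vector `s`, indexed so that the gap between the `j`-th and the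
`(j+1)`-st element is the value at `j`. The values outside `1, …, k - 1` play no role and are
set to `2`. -/
def gapSeq {k : ℕ} (s : Fin k → ℕ) (j : ℕ) : ℕ :=
  if h : 1 ≤ j ∧ j < k then s ⟨j - 1, by omega⟩ else 2

variable {n k : ℕ} {s : Fin k → ℕ}

theorem gapSeq_succ {j : ℕ} (hj : j + 1 < k) : gapSeq s (j + 1) = s ⟨j, by omega⟩ := by
  simp [gapSeq, hj]

theorem two_le_gapSeq (hs : ∀ i : Fin k, (i : ℕ) + 1 < k → 2 ≤ s i) (j : ℕ) :
    2 ≤ gapSeq s j := by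
  unfold gapSeq
  split_ifs with h
  · exact hs _ (by simp only; omega)
  · rfl

theorem le_phi_of_isStable {T : Finset ℕ} (hT : IsStable n k s T) {b : ℝ} (hb : b ≤ 1)
    {x : ℕ → ℝ} (hx : ∀ i ∈ T, b ≤ x i) : b ≤ phi (gapSeq s) k n x := by
  obtain ⟨hsub, t, ht, rfl, hgap, -⟩ := hT
  refine le_phi hb k n (fun j => if h : j < k then t ⟨j, h⟩ else 0) (fun j hj => ?_)
    fun j hj => ?_
  · have hm : t ⟨j, hj⟩ ∈ Finset.univ.image t := Finset.mem_image_of_mem _ (Finset.mem_univ _)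
    simp only [hj, dif_pos]
    exact ⟨(Finset.mem_Icc.1 (hsub hm)).1, (Finset.mem_Icc.1 (hsub hm)).2, hx _ hm⟩
  · simp only [hj, show j < k by omega, dif_pos, gapSeq_succ hj]
    exact hgap ⟨j, by omega⟩ ⟨j + 1, hj⟩ rfl

theorem exists_isStable_of_le_phi (hs : ∀ i : Fin k, (i : ℕ) + 1 < k → 2 ≤ s i)
    (hlast : ∀ i : Fin k, (i : ℕ) + 1 = k → s i = 1) {b : ℝ} (hb : -1 < b) {x : ℕ → ℝ}
    (h : b ≤ phi (gapSeq s) k n x) : ∃ T, IsStable n k s T ∧ ∀ i ∈ T, b ≤ x i := by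
  obtain ⟨t, h1, h2⟩ := exists_of_le_phi hb k n h
  have hmono : ∀ i j, i < j → j < k → t i < t j := by
    intro i j hij
    induction j, hij using Nat.le_induction with
    | base =>
      intro hk
      have := h2 i hk
      have := two_le_gapSeq hs (i + 1)
      simp only [Nat.succ_eq_add_one] at *
      omega
    | succ j _ ih =>
      intro hk
      have := ih (by omega)
      have := h2 j hk
      omega
  refine ⟨Finset.univ.image fun j : Fin k => t j, ⟨?_, fun j => t j,
    fun i j hij => hmono i j hij j.2, rfl, fun i j hij => ?_, fun i j hi hj => ?_⟩, ?_⟩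
  · intro i hi
    obtain ⟨j, -, rfl⟩ := Finset.mem_image.1 hi
    exact Finset.mem_Icc.2 ⟨(h1 j j.2).1, (h1 j j.2).2.1⟩
  · have := h2 i (by omega)
    rw [gapSeq_succ (by omega)] at this
    simp only [← hij]
    exact this
  · have h3 := (h1 i i.2).1
    have h4 := (h1 j j.2).2.1
    rw [hlast j hj]
    simp only
    omega
  · intro i hi
    obtain ⟨j, -, rfl⟩ := Finset.mem_image.1 hi
    exact (h1 j j.2).2.2

end Threshold

/-! ### Points of an order complex -/

section Realization

theorem mem_realization_orderComplex {P : Type*} [Fintype P] [PartialOrder P] {w : P → ℝ} :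
    w ∈ realization (orderComplex P) ↔ w ∈ stdSimplex ℝ P ∧
      IsChain (· ≤ ·) (Function.support w) := by
  classical
  constructor
  · rintro ⟨h, σ, hσ, hw⟩
    refine ⟨h, ?_⟩
    rw [hw]
    exact hσ.2
  · rintro ⟨h, hc⟩
    have hw : Function.support w = ((Finset.univ.filter fun p => w p ≠ 0 : Finset P) : Set P) := by
      ext p; simp
    refine ⟨h, _, ⟨?_, by rwa [← hw]⟩, hw⟩
    rw [← Finset.coe_nonempty, ← hw]
    by_contra hne
    rw [not_nonempty_iff_eq_empty, Function.support_eq_empty_iff] at hne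
    have := h.2
    simp [hne] at this

theorem exists_isLeast_support {P : Type*} [Fintype P] [PartialOrder P] {w : P → ℝ}
    (h : w ∈ realization (orderComplex P)) : ∃ p, IsLeast (Function.support w) p := by
  obtain ⟨-, σ, ⟨hne, hc⟩, hw⟩ := h
  obtain ⟨p, hp⟩ := σ.exists_minimal hne
  refine ⟨p, by rw [hw]; exact hp.1, fun q hq => ?_⟩
  rw [hw] at hq
  rcases hc.total hp.1 hq with h | h
  · exact h
  · exact hp.2 hq h

variable {P : Type*} [Fintype P] [PartialOrder P]

open Classical in
/-- A point of the order complex, at a level `t` strictly between `0` and `1`, singles out the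
element of its chain at which the sum of the weights from the top exceeds `t`. -/
theorem exists_level {w : P → ℝ} (h : w ∈ realization (orderComplex P)) {t : ℝ} (h0 : 0 < t)
    (h1 : t < 1) : ∃ q ∈ Function.support w, t < ∑ p, (if q ≤ p then w p else 0) ∧
      ∑ p, (if q < p then w p else 0) ≤ t := by
  have hw := mem_realization_orderComplex.1 h
  obtain ⟨p0, hp0, hmin⟩ := exists_isLeast_support h
  let S := Finset.univ.filter fun q => w q ≠ 0 ∧ t < ∑ p, (if q ≤ p then w p else 0)
  have hS : S.Nonempty := by
    refine ⟨p0, Finset.mem_filter.2 ⟨Finset.mem_univ _, hp0, ?_⟩⟩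
    have : ∑ p, (if p0 ≤ p then w p else 0) = ∑ p, w p := by
      refine Finset.sum_congr rfl fun p _ => ?_
      by_cases hp : w p = 0
      · simp [hp]
      · rw [if_pos (hmin hp)]
    rw [this, hw.1.2]
    exact h1
  obtain ⟨q, hq⟩ := S.exists_maximal hS
  obtain ⟨-, hq0, hqt⟩ := Finset.mem_filter.1 hq.1
  refine ⟨q, hq0, hqt, ?_⟩
  let R := Finset.univ.filter fun p => w p ≠ 0 ∧ q < p
  rcases R.eq_empty_or_nonempty with hR | hR
  · refine le_trans (Finset.sum_nonpos fun p _ => ?_) h0.le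
    split_ifs with hqp
    · by_contra hp
      have : p ∈ R := Finset.mem_filter.2 ⟨Finset.mem_univ _, fun h => hp h.le, hqp⟩
      simp [hR] at this
    · rfl
  · obtain ⟨r, hr⟩ := R.exists_minimal hR
    obtain ⟨-, hr0, hqr⟩ := Finset.mem_filter.1 hr.1
    have hrS : r ∉ S := fun hrS => (hq.2 hrS hqr.le).not_gt hqr
    have hrt : ∑ p, (if r ≤ p then w p else 0) ≤ t := by
      by_contra! hlt
      exact hrS (Finset.mem_filter.2 ⟨Finset.mem_univ _, hr0, hlt⟩)
    refine le_trans (Finset.sum_le_sum fun p _ => ?_) hrt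
    by_cases hqp : q < p
    · by_cases hp : w p = 0
      · simp [hp]
      · have hpR : p ∈ R := Finset.mem_filter.2 ⟨Finset.mem_univ _, hp, hqp⟩
        have hrp : r ≤ p := by
          rcases hw.2.total hr0 hp with h | h
          · exact h
          · exact hr.2 hpR h
        simp [hqp, hrp]
    · rw [if_neg hqp]
      split_ifs
      · exact hw.1.1 p
      · rfl

open Classical in
theorem level_iff {w : P → ℝ} (h : w ∈ realization (orderComplex P)) {t : ℝ} {q : P}
    (hq : q ∈ Function.support w) (h1 : t < ∑ p, (if q ≤ p then w p else 0))
    (h2 : ∑ p, (if q < p then w p else 0) ≤ t) {A B : P → Prop} [DecidablePred A]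
    [DecidablePred B] (hA : Monotone A)
    (hB : Monotone B) (hAB : ∀ p, A p → ¬ B p) :
    A q ↔ t < ∑ p, w p * ((if A p then 1 else 0) - (if B p then 1 else 0)) := by
  have hw := mem_realization_orderComplex.1 h
  constructor
  · refine fun hAq => h1.trans_le (Finset.sum_le_sum fun p _ => ?_)
    by_cases hp : w p = 0
    · simp [hp]
    have hnB : ¬ B p := fun hBp => by
      rcases hw.2.total hq hp with hqp | hqp
      · exact hAB p (hA hqp hAq) hBp
      · exact hAB q hAq (hB hqp hBp)
    rw [if_neg hnB, sub_zero]
    by_cases hqp : q ≤ p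
    · rw [if_pos hqp, if_pos (hA hqp hAq), mul_one]
    · rw [if_neg hqp]
      exact mul_nonneg (hw.1.1 p) (by split_ifs <;> norm_num)
  · contrapose!
    refine fun hAq => le_trans (Finset.sum_le_sum fun p _ => ?_) h2
    by_cases hp : w p = 0
    · simp [hp]
    by_cases hqp : q < p
    · rw [if_pos hqp]
      refine mul_le_of_le_one_right (hw.1.1 p) ?_
      split_ifs <;> norm_num
    · have hpq : p ≤ q := by
        rcases hw.2.total hq hp with h | h
        · exact (h.eq_or_lt.resolve_right hqp).ge
        · exact h
      rw [if_neg hqp, if_neg (fun hAp => hAq (hA hpq hAp))]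
      exact mul_nonpos_of_nonneg_of_nonpos (hw.1.1 p) (by split_ifs <;> norm_num)

end Realization

/-! ### From the order complex to separated vectors -/

section StableSpace

variable {n k : ℕ} {s : Fin k → ℕ}

/-- The middle of the interval of thresholds that separate `x`. -/
noncomputable def center (s : Fin k → ℕ) (n : ℕ) (x : ℕ → ℝ) : ℝ :=
  (phi (gapSeq s) k n x - phi (gapSeq s) k n (-x)) / 2

/-- Half the length of the interval of thresholds that separate `x`. -/
noncomputable def radius (s : Fin k → ℕ) (n : ℕ) (x : ℕ → ℝ) : ℝ :=
  (phi (gapSeq s) k n x + phi (gapSeq s) k n (-x)) / 2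

/-- The pair `p = (A, B)` consists of the superlevel set of `x` and of `-x` at distance `t` from the
center, and no coordinate lies on the boundary. -/
structure IsLevel (x : ℕ → ℝ) (p : StablePoset n k s) (t : ℝ) : Prop where
  pos : 0 < t
  lt_radius : t < radius s n x
  fst_iff : ∀ i ∈ Finset.Icc 1 n, (i ∈ p.1.1 ↔ t < x i - center s n x)
  snd_iff : ∀ i ∈ Finset.Icc 1 n, (i ∈ p.1.2 ↔ t < -(x i - center s n x))
  ne : ∀ i ∈ Finset.Icc 1 n, x i - center s n x ≠ t ∧ -(x i - center s n x) ≠ t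

/-- An upper bound, given by the index `i`, for the `t` with `IsLevel x p t`. The index `0`, which
belongs to neither set, gives the bound `radius s n x`. -/
noncomputable def upperBound (x : ℕ → ℝ) (p : StablePoset n k s) (i : ℕ) : ℝ :=
  if i ∈ p.1.1 then x i - center s n x else
    if i ∈ p.1.2 then -(x i - center s n x) else radius s n x

/-- A lower bound, given by the index `i`, for the `t` with `IsLevel x p t`. The index `0` stands for
the condition `0 < t`. -/
noncomputable def lowerBound (x : ℕ → ℝ) (p : StablePoset n k s) (i : ℕ) : ℝ :=
  if i = 0 then 0 else max (if i ∈ p.1.1 then 0 else x i - center s n x)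
    (if i ∈ p.1.2 then 0 else -(x i - center s n x))

/-- The length of the interval of all `t` with `IsLevel x p t`. -/
noncomputable def levelWeight (x : ℕ → ℝ) (p : StablePoset n k s) : ℝ :=
  max 0 ((Finset.range (n + 1)).inf' Finset.nonempty_range_add_one (upperBound x p) -
    (Finset.range (n + 1)).sup' Finset.nonempty_range_add_one (lowerBound x p))

theorem continuous_center : Continuous (center s n) := by unfold center; fun_prop

theorem continuous_radius : Continuous (radius s n) := by unfold radius; fun_prop

theorem continuous_levelWeight (p : StablePoset n k s) :
    Continuous fun x => levelWeight x p := by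
  have h1 := continuous_center (s := s) (n := n)
  have h2 := continuous_radius (s := s) (n := n)
  unfold levelWeight
  refine continuous_const.max (Continuous.sub (Continuous.finset_inf'_apply _ fun i _ => ?_)
    (Continuous.finset_sup'_apply _ fun i _ => ?_))
  · unfold upperBound
    split_ifs <;> fun_prop
  · unfold lowerBound
    split_ifs <;> fun_prop

theorem levelWeight_nonneg (x : ℕ → ℝ) (p : StablePoset n k s) : 0 ≤ levelWeight x p :=
  le_max_left _ _

theorem levelWeight_pos_iff {x : ℕ → ℝ} {p : StablePoset n k s} :
    0 < levelWeight x p ↔ ∃ t, IsLevel x p t := by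
  have hA := p.2.1
  have hB := p.2.2.1
  have hAB := Finset.disjoint_left.1 p.2.2.2.1
  have h0A : 0 ∉ p.1.1 := fun h => by simpa using hA h
  have h0B : 0 ∉ p.1.2 := fun h => by simpa using hB h
  have hiff : 0 < levelWeight x p ↔
      (Finset.range (n + 1)).sup' Finset.nonempty_range_add_one (lowerBound x p) <
      (Finset.range (n + 1)).inf' Finset.nonempty_range_add_one (upperBound x p) := by
    rw [levelWeight, lt_max_iff, sub_pos, or_iff_right (lt_irrefl 0)]
  rw [hiff]
  constructor
  · intro h
    obtain ⟨t, hlt, hut⟩ := exists_between h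
    rw [Finset.sup'_lt_iff] at hlt
    rw [Finset.lt_inf'_iff] at hut
    have hl0 := hlt 0 (by simp)
    have hu0 := hut 0 (by simp)
    simp only [lowerBound, if_true] at hl0
    simp only [upperBound, h0A, h0B, if_false] at hu0
    have key : ∀ i ∈ Finset.Icc 1 n, (i ∈ p.1.1 → t < x i - center s n x) ∧
        (i ∉ p.1.1 → x i - center s n x < t) ∧ (i ∈ p.1.2 → t < -(x i - center s n x)) ∧
        (i ∉ p.1.2 → -(x i - center s n x) < t) := by
      intro i hi
      rw [Finset.mem_Icc] at hi
      have hl := hlt i (by simp; omega)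
      have hu := hut i (by simp; omega)
      rw [lowerBound, if_neg (by omega), max_lt_iff] at hl
      rw [upperBound] at hu
      refine ⟨fun h => ?_, fun h => ?_, fun h => ?_, fun h => ?_⟩
      · rwa [if_pos h] at hu
      · rw [if_neg h] at hl; exact hl.1
      · rwa [if_neg fun h' => hAB h' h, if_pos h] at hu
      · rw [if_neg h] at hl; exact hl.2
    refine ⟨t, hl0, hu0, fun i hi => ⟨(key i hi).1, fun h => ?_⟩,
      fun i hi => ⟨(key i hi).2.2.1, fun h => ?_⟩, fun i hi => ⟨?_, ?_⟩⟩
    · by_contra hn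
      exact lt_asymm h ((key i hi).2.1 hn)
    · by_contra hn
      exact lt_asymm h ((key i hi).2.2.2 hn)
    · by_cases h : i ∈ p.1.1
      · exact ((key i hi).1 h).ne'
      · exact ((key i hi).2.1 h).ne
    · by_cases h : i ∈ p.1.2
      · exact ((key i hi).2.2.1 h).ne'
      · exact ((key i hi).2.2.2 h).ne
  · rintro ⟨t, ht⟩
    refine lt_trans (b := t) ?_ ?_
    · rw [Finset.sup'_lt_iff]
      intro i hi
      rw [lowerBound]
      split_ifs with h0 h1 h2 h2
      · exact ht.pos
      · simpa using ht.pos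
      all_goals
        have hi' : i ∈ Finset.Icc 1 n := by
          rw [Finset.mem_range] at hi
          exact Finset.mem_Icc.2 ⟨by omega, by omega⟩
        have e1 := ht.fst_iff i hi'
        have e2 := ht.snd_iff i hi'
        have e3 := ht.ne i hi'
      · exact max_lt ht.pos (lt_of_le_of_ne (not_lt.1 fun h => h2 (e2.2 h)) e3.2)
      · exact max_lt (lt_of_le_of_ne (not_lt.1 fun h => h1 (e1.2 h)) e3.1) ht.pos
      · exact max_lt (lt_of_le_of_ne (not_lt.1 fun h => h1 (e1.2 h)) e3.1)
          (lt_of_le_of_ne (not_lt.1 fun h => h2 (e2.2 h)) e3.2)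
    · rw [Finset.lt_inf'_iff]
      intro i hi
      rw [upperBound]
      split_ifs with h1 h2
      · exact (ht.fst_iff i (hA h1)).1 h1
      · exact (ht.snd_iff i (hB h2)).1 h2
      · exact ht.lt_radius

theorem IsLevel.le {x : ℕ → ℝ} {p q : StablePoset n k s} {t u : ℝ} (hp : IsLevel x p t)
    (hq : IsLevel x q u) (h : t ≤ u) : q ≤ p :=
  ⟨fun i hi => (hp.fst_iff i (q.2.1 hi)).2 (h.trans_lt ((hq.fst_iff i (q.2.1 hi)).1 hi)),
    fun i hi => (hp.snd_iff i (q.2.2.1 hi)).2 (h.trans_lt ((hq.snd_iff i (q.2.2.1 hi)).1 hi))⟩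

theorem isChain_support_levelWeight (x : ℕ → ℝ) :
    IsChain (· ≤ ·) (Function.support (levelWeight x : StablePoset n k s → ℝ)) := by
  have h : ∀ p ∈ Function.support (levelWeight x : StablePoset n k s → ℝ), ∃ t, IsLevel x p t :=
    fun p hp => levelWeight_pos_iff.1 ((levelWeight_nonneg x p).lt_of_ne' hp)
  intro p hp q hq _
  obtain ⟨t, ht⟩ := h p hp
  obtain ⟨u, hu⟩ := h q hq
  rcases le_total t u with htu | htu
  · exact Or.inr (ht.le hu htu)
  · exact Or.inl (hu.le ht htu)

/-- The vector with entries `1` on `A`, `-1` on `B` and `0` elsewhere that represents the pair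
`(A, B)`. -/
noncomputable def signVector (p : StablePoset n k s) (i : ℕ) : ℝ :=
  (if i ∈ p.1.1 then 1 else 0) - (if i ∈ p.1.2 then 1 else 0)

/-- The affine extension to the order complex of the map that represents pairs by sign vectors. -/
noncomputable def toVector (w : StablePoset n k s → ℝ) (i : ℕ) : ℝ := ∑ p, w p * signVector p i

theorem continuous_toVector : Continuous (toVector : (StablePoset n k s → ℝ) → ℕ → ℝ) := by
  unfold toVector; fun_prop

theorem toVector_eq_one {w : StablePoset n k s → ℝ} (hw : ∑ p, w p = 1) {i : ℕ}
    (h : ∀ p, w p ≠ 0 → i ∈ p.1.1) : toVector w i = 1 := by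
  rw [← hw]
  refine Finset.sum_congr rfl fun p _ => ?_
  by_cases hp : w p = 0
  · simp [hp]
  · have h1 := h p hp
    have h2 := Finset.disjoint_left.1 p.2.2.2.1 h1
    simp [signVector, h1, h2]

theorem neg_toVector_eq_one {w : StablePoset n k s → ℝ} (hw : ∑ p, w p = 1) {i : ℕ}
    (h : ∀ p, w p ≠ 0 → i ∈ p.1.2) : (-toVector w) i = 1 := by
  rw [← hw, Pi.neg_apply, toVector, ← Finset.sum_neg_distrib]
  refine Finset.sum_congr rfl fun p _ => ?_
  by_cases hp : w p = 0
  · simp [hp]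
  · have h1 := h p hp
    have h2 := Finset.disjoint_right.1 p.2.2.2.1 h1
    simp [signVector, h1, h2]

/-- The least element of the chain carrying a point of the order complex contains stable sets on
which the vector of this point has the extreme values `1` and `-1`. -/
theorem phi_toVector {w : StablePoset n k s → ℝ}
    (hw : w ∈ realization (orderComplex (StablePoset n k s))) :
    phi (gapSeq s) k n (toVector w) = 1 ∧ phi (gapSeq s) k n (-toVector w) = 1 := by
  obtain ⟨p, -, hmin⟩ := exists_isLeast_support hw
  have hsum := hw.1.2
  obtain ⟨-, -, -, ⟨T, hTA, hT⟩, ⟨T', hTB, hT'⟩⟩ := p.2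
  constructor
  · refine le_antisymm (phi_le_one _ _ _) (le_phi_of_isStable hT le_rfl fun i hi => ?_)
    rw [toVector_eq_one hsum fun q hq => (hmin hq).1 (hTA hi)]
  · refine le_antisymm (phi_le_one _ _ _) (le_phi_of_isStable hT' le_rfl fun i hi => ?_)
    rw [neg_toVector_eq_one hsum fun q hq => (hmin hq).2 (hTB hi)]

theorem toVector_mem {w : StablePoset n k s → ℝ}
    (hw : w ∈ realization (orderComplex (StablePoset n k s))) :
    toVector w ∈ pairSet (gapSeq s) k n k n := by
  rw [mem_pairSet, (phi_toVector hw).1, (phi_toVector hw).2]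
  norm_num

/-- The level sets of the vector of a point of the order complex belong to the chain that carries
the point. -/
theorem mem_support_of_isLevel {w : StablePoset n k s → ℝ}
    (hw : w ∈ realization (orderComplex (StablePoset n k s))) {p : StablePoset n k s} {t : ℝ}
    (h : IsLevel (toVector w) p t) : w p ≠ 0 := by
  classical
  obtain ⟨h1, h2⟩ := phi_toVector hw
  have hc : center s n (toVector w) = 0 := by rw [center, h1, h2]; norm_num
  have hr : radius s n (toVector w) = 1 := by rw [radius, h1, h2]; norm_num
  obtain ⟨q, hq, hq1, hq2⟩ := exists_level hw h.pos (hr ▸ h.lt_radius)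
  suffices p = q by rw [this]; exact hq
  have hA : ∀ i, Monotone fun r : StablePoset n k s => i ∈ r.1.1 := fun i r r' h hi => h.1 hi
  have hB : ∀ i, Monotone fun r : StablePoset n k s => i ∈ r.1.2 := fun i r r' h hi => h.2 hi
  refine Subtype.ext (Prod.ext (Finset.ext fun i => ?_) (Finset.ext fun i => ?_))
  · by_cases hi : i ∈ Finset.Icc 1 n
    · rw [h.fst_iff i hi, hc, sub_zero]
      refine Iff.symm ((level_iff hw hq hq1 hq2 (hA i) (hB i) fun r hr =>
        Finset.disjoint_left.1 r.2.2.2.1 hr).trans ?_)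
      simp only [toVector, signVector]
    · exact iff_of_false (fun h => hi (p.2.1 h)) (fun h => hi (q.2.1 h))
  · by_cases hi : i ∈ Finset.Icc 1 n
    · rw [h.snd_iff i hi, hc, sub_zero]
      refine Iff.symm ((level_iff hw hq hq1 hq2 (hB i) (hA i) fun r hr =>
        Finset.disjoint_right.1 r.2.2.2.1 hr).trans ?_)
      rw [toVector, ← Finset.sum_neg_distrib]
      simp only [signVector, ← mul_neg, neg_sub]
    · exact iff_of_false (fun h => hi (p.2.2.1 h)) (fun h => hi (q.2.2.1 h))

/-- The weights of `levelWeight`, normalized to have sum `1`. -/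
noncomputable def fromVector (x : ℕ → ℝ) (p : StablePoset n k s) : ℝ :=
  levelWeight x p / ∑ q : StablePoset n k s, levelWeight x q

variable (hs : ∀ i : Fin k, (i : ℕ) + 1 < k → 2 ≤ s i)
  (hlast : ∀ i : Fin k, (i : ℕ) + 1 = k → s i = 1)
include hs hlast

theorem exists_extremal {x : ℕ → ℝ} (hx : x ∈ pairSet (gapSeq s) k n k n) :
    ∃ T T', IsStable n k s T ∧ IsStable n k s T' ∧
      (∀ i ∈ T, phi (gapSeq s) k n x ≤ x i) ∧ (∀ i ∈ T', phi (gapSeq s) k n (-x) ≤ (-x) i) := by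
  rw [mem_pairSet] at hx
  have h1 := phi_le_one (g := gapSeq s) k n x
  have h2 := phi_le_one (g := gapSeq s) k n (-x)
  obtain ⟨T, hT, hTx⟩ := exists_isStable_of_le_phi hs hlast (by linarith)
    (le_refl (phi (gapSeq s) k n x))
  obtain ⟨T', hT', hTx'⟩ := exists_isStable_of_le_phi hs hlast (by linarith)
    (le_refl (phi (gapSeq s) k n (-x)))
  exact ⟨T, T', hT, hT', hTx, hTx'⟩

theorem exists_isLevel {x : ℕ → ℝ} (hx : x ∈ pairSet (gapSeq s) k n k n) :
    ∃ (p : StablePoset n k s) (t : ℝ), IsLevel x p t := by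
  classical
  obtain ⟨T, T', hT, hT', hTx, hTx'⟩ := exists_extremal hs hlast hx
  rw [mem_pairSet] at hx
  have hr : 0 < radius s n x := by rw [radius]; linarith
  -- all but finitely many values are attained by no coordinate
  obtain ⟨t, ⟨ht0, ht1⟩, ht⟩ := ((Ioo_infinite hr).sdiff
    (((Finset.Icc 1 n).image fun i => x i - center s n x) ∪
      ((Finset.Icc 1 n).image fun i => -(x i - center s n x))).finite_toSet).nonempty
  simp only [Finset.coe_union, Finset.coe_image, mem_union, mem_image, Finset.mem_coe,
    not_or, not_exists, not_and] at ht
  refine ⟨⟨((Finset.Icc 1 n).filter fun i => t < x i - center s n x,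
    (Finset.Icc 1 n).filter fun i => t < -(x i - center s n x)),
    Finset.filter_subset _ _, Finset.filter_subset _ _, ?_, ⟨T, fun i hi => ?_, hT⟩,
    ⟨T', fun i hi => ?_, hT'⟩⟩, t, ht0, ht1, fun i hi => ?_, fun i hi => ?_, fun i hi =>
    ⟨ht.1 i hi, ht.2 i hi⟩⟩
  · rw [Finset.disjoint_left]
    intro i h1 h2
    have h3 := (Finset.mem_filter.1 h1).2
    have h4 := (Finset.mem_filter.1 h2).2
    linarith
  · refine Finset.mem_filter.2 ⟨hT.1 hi, ?_⟩
    have := hTx i hi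
    simp only [radius, center] at *
    linarith
  · refine Finset.mem_filter.2 ⟨hT'.1 hi, ?_⟩
    have := hTx' i hi
    simp only [radius, center, Pi.neg_apply] at *
    linarith
  · exact Finset.mem_filter.trans (and_iff_right hi)
  · exact Finset.mem_filter.trans (and_iff_right hi)

theorem sum_levelWeight_pos {x : ℕ → ℝ} (hx : x ∈ pairSet (gapSeq s) k n k n) :
    0 < ∑ q : StablePoset n k s, levelWeight x q := by
  obtain ⟨p, hp⟩ := exists_isLevel hs hlast hx
  exact Finset.sum_pos' (fun q _ => levelWeight_nonneg x q)
    ⟨p, Finset.mem_univ _, levelWeight_pos_iff.2 hp⟩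

omit hs hlast in
theorem isLevel_of_fromVector_ne_zero {x : ℕ → ℝ} {p : StablePoset n k s}
    (hp : fromVector x p ≠ 0) : ∃ t, IsLevel x p t :=
  levelWeight_pos_iff.1 ((levelWeight_nonneg x p).lt_of_ne' (div_ne_zero_iff.1 hp).1)

theorem fromVector_mem {x : ℕ → ℝ} (hx : x ∈ pairSet (gapSeq s) k n k n) :
    (fromVector x : StablePoset n k s → ℝ) ∈ realization (orderComplex (StablePoset n k s)) := by
  have hpos := sum_levelWeight_pos hs hlast hx
  refine mem_realization_orderComplex.2 ⟨⟨fun p => div_nonneg (levelWeight_nonneg x p) hpos.le, ?_⟩,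
    (isChain_support_levelWeight x).mono fun p hp => (div_ne_zero_iff.1 hp).1⟩
  simp only [fromVector]
  rw [← Finset.sum_div, div_self hpos.ne']

/-- The order complex of the poset of stable pairs is homotopy equivalent to the set of separated
vectors: a point of the complex is sent to a vector, and a vector to the chain of its pairs of
level sets. -/
theorem stableSpace_equiv_pairSet :
    Nonempty (HomotopyEquiv (StableSpace n k s) (pairSet (gapSeq s) k n k n)) := by
  let X := realization (orderComplex (StablePoset n k s))
  let U := pairSet (gapSeq s) k n k n
  let F : C(X, U) := ⟨fun w => ⟨toVector w.1, toVector_mem w.2⟩,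
    (continuous_toVector.comp continuous_subtype_val).subtype_mk _⟩
  let G : C(U, X) := ⟨fun x => ⟨fromVector x, fromVector_mem hs hlast x.2⟩, by
    refine Continuous.subtype_mk (continuous_pi fun p => ?_) _
    have h := fun q : StablePoset n k s =>
      (continuous_levelWeight q).comp (continuous_subtype_val (p := (· ∈ U)))
    exact (h p).div (continuous_finsetSum _ fun q _ => h q)
      fun x => (sum_levelWeight_pos hs hlast x.2).ne'⟩
  refine ⟨⟨F, G, homotopic_of_segment_subset _ _ fun w u h0 h1 => ?_,
    Homotopic.symm (homotopic_of_segment_subset _ _ fun x u h0 h1 => ?_)⟩⟩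
  · have hw := mem_realization_orderComplex.1 w.2
    have hGw := mem_realization_orderComplex.1 (fromVector_mem hs hlast (toVector_mem w.2))
    refine mem_realization_orderComplex.2 ⟨convex_stdSimplex ℝ _ hGw.1 hw.1
      (sub_nonneg.2 h1) h0 (by ring), hw.2.mono fun p hp => ?_⟩
    by_contra hwp
    rw [Function.mem_support, not_not] at hwp
    have h2 : fromVector (toVector w.1) p ≠ 0 := fun h2 => hp (by
      change (1 - u) * fromVector (toVector w.1) p + u * w.1 p = 0
      rw [h2, hwp]; ring)
    obtain ⟨t, ht⟩ := isLevel_of_fromVector_ne_zero h2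
    exact mem_support_of_isLevel w.2 ht hwp
  · change (1 - u) • (x : ℕ → ℝ) + u • toVector (fromVector x : StablePoset n k s → ℝ) ∈ U
    obtain ⟨T, T', hT, hT', hTx, hTx'⟩ := exists_extremal hs hlast x.2
    have hsum := (fromVector_mem hs hlast x.2).1.2
    have hx : (0 : ℝ) < _ := x.2
    have ha := phi_le_one (g := gapSeq s) k n x
    have hb := phi_le_one (g := gapSeq s) k n (-x)
    have h2 : (1 - u) * phi (gapSeq s) k n x + u ≤ phi (gapSeq s) k n
        ((1 - u) • (x : ℕ → ℝ) + u • toVector (fromVector x : StablePoset n k s → ℝ)) := by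
      refine le_phi_of_isStable hT (by nlinarith) fun i hi => ?_
      have h3 : toVector (fromVector x : StablePoset n k s → ℝ) i = 1 :=
        toVector_eq_one hsum fun p hp => by
          obtain ⟨t, ht⟩ := isLevel_of_fromVector_ne_zero hp
          refine (ht.fst_iff i (hT.1 hi)).2 (ht.lt_radius.trans_le ?_)
          have := hTx i hi
          simp only [radius, center]
          linarith
      simp only [Pi.add_apply, Pi.smul_apply, smul_eq_mul, h3, mul_one]
      have := mul_le_mul_of_nonneg_left (hTx i hi) (sub_nonneg.2 h1)
      linarith
    have h2' : (1 - u) * phi (gapSeq s) k n (-x) + u ≤ phi (gapSeq s) k n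
        (-((1 - u) • (x : ℕ → ℝ) + u • toVector (fromVector x : StablePoset n k s → ℝ))) := by
      refine le_phi_of_isStable hT' (by nlinarith) fun i hi => ?_
      have h3 : (-toVector (fromVector x : StablePoset n k s → ℝ)) i = 1 :=
        neg_toVector_eq_one hsum fun p hp => by
          obtain ⟨t, ht⟩ := isLevel_of_fromVector_ne_zero hp
          refine (ht.snd_iff i (hT'.1 hi)).2 (ht.lt_radius.trans_le ?_)
          have := hTx' i hi
          simp only [radius, center, Pi.neg_apply] at *
          linarith
      have := mul_le_mul_of_nonneg_left (hTx' i hi) (sub_nonneg.2 h1)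
      simp only [Pi.add_apply, Pi.smul_apply, smul_eq_mul, Pi.neg_apply] at *
      rw [neg_eq_iff_eq_neg] at h3
      rw [h3]
      linarith
    rw [mem_pairSet]
    refine lt_of_lt_of_le ?_ (add_le_add h2 h2')
    rcases h0.eq_or_lt with rfl | h0
    · simpa using hx
    · nlinarith [mul_nonneg (sub_nonneg.2 h1) hx.le]

end StableSpace

end StableKneser

/-! ### The homotopy type -/

theorem mainTheorem3 (n k : ℕ) (hk : 2 ≤ k) (s : Fin k → ℕ)
    (hs : ∀ i : Fin k, (i : ℕ) + 1 < k → 2 ≤ s i)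
    (hlast : ∀ i : Fin k, (i : ℕ) + 1 = k → s i = 1)
    (hn : (∑ i ∈ Finset.univ.filter (fun i : Fin k => (i : ℕ) + 1 < k), s i) + 2 ≤ n) :
    Nonempty (ContinuousMap.HomotopyEquiv (StableKneser.StableSpace n k s)
      (StableKneser.Sphere (n - (∑ i ∈ Finset.univ.filter (fun i : Fin k => (i : ℕ) + 1 < k), s i) - 2))) ∧
    StableKneser.IsMConnected
      ((n : ℤ) - (∑ i ∈ Finset.univ.filter (fun i : Fin k => (i : ℕ) + 1 < k), (s i : ℤ)) - 3)
      (StableKneser.StableSpace n k s) := by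
  obtain ⟨k, rfl⟩ : ∃ m, k = m + 1 := ⟨k - 1, by omega⟩
  have hsum : ∑ i ∈ Finset.univ.filter (fun i : Fin (k + 1) => (i : ℕ) + 1 < k + 1), s i =
      ∑ j ∈ Finset.range k, StableKneser.gapSeq s (j + 1) := by
    refine Finset.sum_nbij (fun i => (i : ℕ)) (fun i hi => ?_) (fun i _ j _ h => Fin.ext h)
      (fun j hj => ?_) (fun i hi => ?_)
    · simpa using hi
    · have hj' : j < k := by simpa using hj
      exact ⟨⟨j, by omega⟩, by simpa using hj', rfl⟩
    · rw [StableKneser.gapSeq_succ (by simpa using hi)]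
  have hcast : ∑ i ∈ Finset.univ.filter (fun i : Fin (k + 1) => (i : ℕ) + 1 < k + 1), (s i : ℤ) =
      ((∑ i ∈ Finset.univ.filter (fun i : Fin (k + 1) => (i : ℕ) + 1 < k + 1), s i : ℕ) : ℤ) := by
    push_cast; rfl
  rw [hcast]
  rw [hsum] at hn ⊢
  set σ := ∑ j ∈ Finset.range k, StableKneser.gapSeq s (j + 1) with hσ
  obtain ⟨d, rfl⟩ : ∃ d, n = σ + 1 + (d + 1) := ⟨n - σ - 2, by omega⟩
  obtain ⟨e1⟩ := StableKneser.stableSpace_equiv_pairSet (n := σ + 1 + (d + 1)) hs hlast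
  obtain ⟨e2⟩ := StableKneser.pairSet_equiv_sphere (StableKneser.two_le_gapSeq hs) k (d + 1)
  have e : ContinuousMap.HomotopyEquiv (StableKneser.StableSpace (σ + 1 + (d + 1)) (k + 1) s)
      (StableKneser.Sphere d) := e1.trans e2
  rw [show σ + 1 + (d + 1) - σ - 2 = d by omega]
  exact ⟨⟨e⟩, StableKneser.isMConnected_of_equiv_sphere e (by push_cast; omega)⟩
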